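/- Let $n\ge 1$, let $K\subseteq\mathbb R^2$ be convex with $0$ in its interior (for example a square centred at $0$, a disc, or the whole plane), and let $I\subseteq\mathbb R$ be an interval with non-empty interior. Let $X$ be the product with $I$ of the cone of cone angle $2\pi n$, built as follows: take $n$ copies of $K\times I\subset\mathbb R^3$ (unit cubes, when $K$ is a unit square and $I$ a unit interval), cut each along the half plane $\{y=0,\ x\ge 0\}$, and identify, cyclically, the upper side of the cut of each copy with the lower side of the cut of the next copy; give $X$ the induced length metric. Let $\mathrm{dev}:X\to\mathbb R^3$ be the map that is the inclusion on each copy, and let the axis be the set of points of $X$ over $\{x=y=0\}$. Let $\nu\in\mathbb R^3\setminus\{0\}$ be any direction and put on every copy the foliation by the planes orthogonal to $\nu$. These match across the identifications and give a (singular) foliation of $X$ by hyperplanes, whose leaves are the connected components of the level sets $\{x\in X:\langle\nu,\mathrm{dev}(x)\rangle=c\}$, $c\in\mathbb R$. If such a level set contains the axis, it consists of $2n$ half planes (cut off by $K\times I$) meeting along the axis, and each union of two different ones of these half planes is also called a leaf. Then every leaf $L$ is globally area minimizing: for every rectifiable simple closed curve $\gamma$ in $L$ there is a surface $S$ contained in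 $L$ with boundary $\gamma$ whose area is at most that of every surface $S'$ in $X$ with boundary $\gamma$. Here a surface is a compact oriented Lipschitz surface of any topological type, i.e. a finite integral combination of Lipschitz maps of the unit square into $X$; it has boundary $\gamma$ if $\int_S df\wedge dg=\int_\gamma f\,dg$ for all Lipschitz functions $f,g$ on $X$; and its area is its mass, the supremum of $\int_S\omega$ over the continuous 2-forms $\omega$ of comass at most $1$ (area counted with multiplicity). -/

import Mathlib

open scoped NNReal ENNReal

namespace FlatCone

/-- Euclidean three-space; the coordinates `0, 1` are horizontal, the coordinate `2` is vertical. -/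
abbrev E3 : Type := EuclideanSpace ℝ (Fin 3)

/-! ### The space: `n` copies of `K × I`, cut along a vertical half plane and glued in a cycle -/

/-- A point of one of the `n` cut copies of `K × I ⊆ ℝ² × ℝ`. Each copy is slit along the vertical
half plane `y = 0, x ≥ 0`; the slit copy is recorded as its upper half (`y ≥ 0`) and its lower half
(`y ≤ 0`), so that every point of the slit half plane occurs twice, once on each side of the cut. -/
structure CutPoint (n : ℕ) (K : Set (EuclideanSpace ℝ (Fin 2))) (I : Set ℝ) where
  copy : Fin n
  upper : Bool
  pos : E3
  horizontal_mem : !₂[pos 0, pos 1] ∈ K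
  vertical_mem : pos 2 ∈ I
  side : if upper = true then 0 ≤ pos 1 else pos 1 ≤ 0

variable {n : ℕ} {K : Set (EuclideanSpace ℝ (Fin 2))} {I : Set ℝ}

/-- The two halves of one copy are attached along `y = 0, x ≤ 0`, which is not cut. -/
def GluedInCopy (a b : CutPoint n K I) : Prop :=
  a.pos = b.pos ∧ a.copy = b.copy ∧ a.pos 1 = 0 ∧ a.pos 0 ≤ 0

/-- The upper side of the slit of a copy is attached to the lower side of the slit of the next copy,
cyclically. -/
def GluedToNext [NeZero n] (a b : CutPoint n K I) : Prop :=
  a.pos = b.pos ∧ a.upper = true ∧ b.upper = false ∧ b.copy = a.copy + 1 ∧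
    a.pos 1 = 0 ∧ 0 ≤ a.pos 0

/-- `BrokenPath a b ℓ`: a broken line of length `ℓ` leads from `a` to `b`. It consists of straight
segments inside the (convex) halves of the copies and of passages between attached points, which
have no length. -/
inductive BrokenPath [NeZero n] : CutPoint n K I → CutPoint n K I → ℝ≥0∞ → Prop
  | segment (a b : CutPoint n K I) (hc : a.copy = b.copy) (hu : a.upper = b.upper) :
      BrokenPath a b (edist a.pos b.pos)
  | inCopy (a b : CutPoint n K I) (h : GluedInCopy a b) : BrokenPath a b 0
  | toNext (a b : CutPoint n K I) (h : GluedToNext a b) : BrokenPath a b 0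
  | symm {a b : CutPoint n K I} {l : ℝ≥0∞} (h : BrokenPath a b l) : BrokenPath b a l
  | trans {a b c : CutPoint n K I} {l m : ℝ≥0∞} (h : BrokenPath a b l) (h' : BrokenPath b c m) :
      BrokenPath a c (l + m)

/-- The length pseudometric on the disjoint union of the cut copies; attached points have
distance `0`. -/
noncomputable instance [NeZero n] : PseudoEMetricSpace (CutPoint n K I) where
  edist a b := sInf {l : ℝ≥0∞ | BrokenPath a b l}
  edist_self a := le_antisymm
    (sInf_le (by simpa using BrokenPath.segment a a rfl rfl)) zero_le
  edist_comm a b := by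
    have h : {l : ℝ≥0∞ | BrokenPath a b l} = {l : ℝ≥0∞ | BrokenPath b a l} :=
      Set.ext fun l => ⟨BrokenPath.symm, BrokenPath.symm⟩
    exact congrArg sInf h
  edist_triangle a b c := by
    rw [ENNReal.sInf_add]
    refine le_iInf₂ fun l hl => ?_
    rw [add_comm, ENNReal.sInf_add]
    refine le_iInf₂ fun m hm => ?_
    rw [add_comm]
    exact sInf_le (BrokenPath.trans hl hm)

theorem BrokenPath.edist_pos_le [NeZero n] {a b : CutPoint n K I} {l : ℝ≥0∞}
    (h : BrokenPath a b l) : edist a.pos b.pos ≤ l := by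
  induction h with
  | segment a b hc hu => exact le_rfl
  | inCopy a b h => simp [h.1]
  | toNext a b h => simp [h.1]
  | symm h ih => rwa [edist_comm]
  | trans h h' ih ih' => exact (edist_triangle _ _ _).trans (add_le_add ih ih')

theorem CutPoint.edist_pos_le [NeZero n] (a b : CutPoint n K I) :
    edist a.pos b.pos ≤ edist a b :=
  le_sInf fun _ hl => BrokenPath.edist_pos_le hl

variable (n K I) in
/-- The product of a cone of cone angle `2πn` with the interval `I`: the `n` cut copies of `K × I`
with attached points identified (the points at distance `0` are exactly the attached ones),
carrying the induced length metric. -/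
abbrev ConeProduct [NeZero n] : Type := SeparationQuotient (CutPoint n K I)

/-- The map to `ℝ³` which on each copy is the inclusion. It is a local isometry off the axis. -/
noncomputable def dev [NeZero n] : ConeProduct n K I → E3 :=
  SeparationQuotient.lift CutPoint.pos fun a b hab =>
    edist_le_zero.1 ((CutPoint.edist_pos_le a b).trans
      (EMetric.inseparable_iff.1 hab).le)

/-! ### The foliation by hyperplanes orthogonal to `ν` -/

/-- The singular set: the product of the apex of the cone with the interval. -/
def axis [NeZero n] : Set (ConeProduct n K I) := {x | dev x 0 = 0 ∧ dev x 1 = 0}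

/-- The union of the copies of the plane `⟨ν, p⟩ = c`. -/
def level [NeZero n] (ν : E3) (c : ℝ) : Set (ConeProduct n K I) := {x | inner ℝ ν (dev x) = c}

/-- The leaves of the foliation with normal direction `ν`, obtained by putting the foliation by the
planes orthogonal to `ν` on each copy: the planes of the copies join across the gluing, and the
leaves are the connected components of their unions. A plane that contains the axis gives `2n` half
planes which meet along the axis, where leaves may intersect; besides the connected set formed by
all of them, each surface formed by two of them is also counted as a leaf. -/
inductive IsLeaf [NeZero n] (ν : E3) : Set (ConeProduct n K I) → Prop
  | component (x : ConeProduct n K I) :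
      IsLeaf ν (connectedComponentIn (level ν (inner ℝ ν (dev x))) x)
  | halfPlanes (c : ℝ) (hc : axis ⊆ (level ν c : Set (ConeProduct n K I)))
      (x y : ConeProduct n K I) (hx : x ∈ level ν c \ axis) (hy : y ∈ level ν c \ axis)
      (hxy : connectedComponentIn (level ν c \ axis) x ≠
        connectedComponentIn (level ν c \ axis) y) :
      IsLeaf ν (axis ∪ connectedComponentIn (level ν c \ axis) x ∪
        connectedComponentIn (level ν c \ axis) y)

/-! ### Curves, surfaces, area -/

/-- `γ`, restricted to `[0, 1]`, is a rectifiable (Lipschitz parametrized) simple closed curve. -/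
def IsSimpleClosedCurve [NeZero n] (γ : ℝ → ConeProduct n K I) : Prop :=
  (∃ C : ℝ≥0, LipschitzOnWith C γ (Set.Icc 0 1)) ∧ γ 0 = γ 1 ∧ Set.InjOn γ (Set.Ico 0 1)

/-- The parameter square. -/
def square : Set (ℝ × ℝ) := Set.Icc 0 1 ×ˢ Set.Icc 0 1

variable (n K I) in
/-- A compact oriented Lipschitz surface, of any topological type: finitely many Lipschitz
patches with integer multiplicities (a Lipschitz 2-chain). -/
structure Surface [NeZero n] where
  size : ℕ
  mult : Fin size → ℤ
  patch : Fin size → ℝ × ℝ → ConeProduct n K I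
  lipschitz : ∀ i, ∃ C : ℝ≥0, LipschitzOnWith C (patch i) square

/-- The set of points of the surface. -/
def Surface.carrier [NeZero n] (S : Surface n K I) : Set (ConeProduct n K I) :=
  ⋃ i, S.patch i '' square

/-- `∂S = γ` in the sense of Stokes: `∫_S df ∧ dg = ∫_γ f dg` for all Lipschitz functions `f, g`. -/
def Surface.HasBoundary [NeZero n] (S : Surface n K I) (γ : ℝ → ConeProduct n K I) : Prop :=
  ∀ f g : ConeProduct n K I → ℝ, (∃ C : ℝ≥0, LipschitzWith C f) → (∃ C : ℝ≥0, LipschitzWith C g) →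
    ∑ i, (S.mult i : ℝ) * ∫ q in square,
        (fderiv ℝ (f ∘ S.patch i) q (1, 0) * fderiv ℝ (g ∘ S.patch i) q (0, 1) -
          fderiv ℝ (f ∘ S.patch i) q (0, 1) * fderiv ℝ (g ∘ S.patch i) q (1, 0)) =
      ∫ t in (0 : ℝ)..1, f (γ t) * deriv (g ∘ γ) t

/-- The triple product `⟨u, v × w⟩`. -/
noncomputable def tripleProduct (u v w : E3) : ℝ :=
  Matrix.det !![u 0, u 1, u 2; v 0, v 1, v 2; w 0, w 1, w 2]

/-- The flux of the vector field `V` through `S`, that is, the integral over `S` of the 2-form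
`V ⌟ (dx ∧ dy ∧ dz)`. -/
noncomputable def Surface.flux [NeZero n] (S : Surface n K I) (V : ConeProduct n K I → E3) : ℝ :=
  ∑ i, (S.mult i : ℝ) * ∫ q in square,
    tripleProduct (V (S.patch i q)) (fderiv ℝ (dev ∘ S.patch i) q (1, 0))
      (fderiv ℝ (dev ∘ S.patch i) q (0, 1))

/-- The area of a surface, counted with multiplicity: its mass, the supremum of the integrals over
`S` of the continuous 2-forms of comass at most `1`. -/
noncomputable def Surface.area [NeZero n] (S : Surface n K I) : ℝ≥0∞ :=
  ⨆ (V : ConeProduct n K I → E3) (_ : Continuous V) (_ : ∀ x, ‖V x‖ ≤ 1), ENNReal.ofReal (S.flux V)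

/-- `L` is globally area minimizing: for every simple closed curve in `L`, among the surfaces in the
whole space that have the curve as boundary, one of minimal area is contained in `L`. -/
def IsAreaMinimizing [NeZero n] (L : Set (ConeProduct n K I)) : Prop :=
  ∀ γ : ℝ → ConeProduct n K I, IsSimpleClosedCurve γ → (∀ t ∈ Set.Icc (0 : ℝ) 1, γ t ∈ L) →
    ∃ S : Surface n K I, S.carrier ⊆ L ∧ S.HasBoundary γ ∧
      ∀ S' : Surface n K I, S'.HasBoundary γ → S.area ≤ S'.area

end FlatCone

open scoped NNReal ENNReal
open MeasureTheory Filter Topology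

namespace FlatCone

section

/-! ### Stokes' theorem for Lipschitz functions on the square -/

/-! The area comparison is a calibration argument. Let `S` lie in a level set and put `u = ν/‖ν‖`.
Tangent planes of `S` are orthogonal to `u`, so the flux of `V` through `S` is that of `h u`, `h =
⟨V, u⟩`. In `ℝ³` one extends `h` constantly along `u`; then `h u` is divergence free, has the same
flux through a competitor `S'`, and this is at most the area of `S'`.

On the cone product take an orthonormal basis `e, σ` of the plane orthogonal to `u`, with `e`
horizontal (`exists_frame`). The wall `⟨e, dev⟩ = 0` contains the axis and leaves `2n` open half
spaces, each isometric to a convex set (`edist_le_of_sheet_eq`). There `h` on the level is a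
function of `⟨σ, dev⟩, ⟨e, dev⟩`; replace it by a Lipschitz approximation `k` times a cutoff `ρ`
vanishing on the wall. Then `k ρ de ∧ dσ = df ∧ dσ`, where `f` is a primitive in the direction `e`
vanishing on the wall (`ae_wedge_potential`). Since `ρ` and `f` vanish there, the unrelated choices
on different half spaces glue to Lipschitz functions (`lipschitzWith_glue`), and the flux depends
only on the boundary (`flux_calibration_eq`). Removing the cutoff loses nothing, as the part of `S`
in the wall has zero area element (`ae_fderiv_eq_zero`).

A spanning surface is a Lipschitz null homotopy: the cone over the curve from a point of the axis if
the plane meets the axis, otherwise a straight-line homotopy in a single half space. That it bounds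
the curve is Stokes' formula for Lipschitz functions on the square. -/

theorem lipschitzWith_mul_of_bounded {α : Type*} [PseudoMetricSpace α] {f g : α → ℝ} {C D : ℝ≥0}
    (hf : LipschitzWith C f) (hg : LipschitzWith D g) {A B : ℝ≥0} (hA : ∀ x, |f x| ≤ A)
    (hB : ∀ x, |g x| ≤ B) : LipschitzWith (A * D + B * C) (fun x => f x * g x) := by
  refine LipschitzWith.of_dist_le_mul fun x y => ?_
  have h1 := hf.dist_le_mul x y
  have h2 := hg.dist_le_mul x y
  rw [Real.dist_eq] at h1 h2 ⊢
  have : f x * g x - f y * g y = f x * (g x - g y) + g y * (f x - f y) := by ring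
  rw [this]
  calc _ ≤ |f x| * |g x - g y| + |g y| * |f x - f y| := by
        rw [← abs_mul, ← abs_mul]; exact abs_add_le _ _
    _ ≤ A * (D * dist x y) + B * (C * dist x y) := by
        gcongr
        · exact hA x
        · exact hB y
    _ = _ := by push_cast; ring

section Weak

variable {E : Type*} [NormedAddCommGroup E] [NormedSpace ℝ E]

theorem hasCompactSupport_lineDeriv {F : E → ℝ} (hF : HasCompactSupport F) (v : E) :
    HasCompactSupport fun x => lineDeriv ℝ F x v := by
  refine HasCompactSupport.of_support_subset_isCompact hF fun x hx => ?_
  by_contra hx'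
  apply hx
  have h : F =ᶠ[𝓝 x] fun _ => 0 := notMem_tsupport_iff_eventuallyEq.1 hx'
  simp only [h.lineDeriv_eq]
  simp [lineDeriv]

theorem integrable_lineDeriv [MeasurableSpace E] [BorelSpace E] {μ : Measure E}
    [IsFiniteMeasureOnCompacts μ] {F : E → ℝ} {C : ℝ≥0} (hF : LipschitzWith C F)
    (hc : HasCompactSupport F) (v : E) : Integrable (fun x => lineDeriv ℝ F x v) μ := by
  have h : IntegrableOn (fun x => lineDeriv ℝ F x v) (tsupport fun x => lineDeriv ℝ F x v) μ :=
    Measure.integrableOn_of_bounded (hasCompactSupport_lineDeriv hc v).isCompact.measure_ne_top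
      (aestronglyMeasurable_lineDeriv hF.continuous μ) (M := C * ‖v‖)
      (.of_forall fun _ => norm_lineDeriv_le_of_lipschitz ℝ hF)
  exact (integrableOn_iff_integrable_of_support_subset (subset_tsupport _)).1 h

/-- The weak form of `d(dF ∧ dG) = 0` for Lipschitz functions. -/
theorem integral_lineDeriv_mul_lineDeriv_comm [MeasurableSpace E] [BorelSpace E]
    [FiniteDimensional ℝ E] {μ : Measure E} [μ.IsAddHaarMeasure] {F G : E → ℝ} {C D : ℝ≥0} (hF : LipschitzWith C F)
    (hG : LipschitzWith D G) (hc : HasCompactSupport F) (u v : E) :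
    ∫ x, lineDeriv ℝ F x u * lineDeriv ℝ G x v ∂μ =
      ∫ x, lineDeriv ℝ F x v * lineDeriv ℝ G x u ∂μ := by
  -- A compact set carrying all translates of `F` by `t • u`, `0 ≤ t ≤ 1`; truncating the derivative
  -- of `G` to it yields an integrable factor without changing the integrals.
  set Z := Metric.cthickening ‖u‖ (tsupport F)
  have hZ : IsCompact Z := hc.isCompact.cthickening
  have hFZ : ∀ x ∉ Z, ∀ t : ℝ, 0 ≤ t → t ≤ 1 → F (x + t • (-u)) = 0 := by
    intro x hx t ht ht1
    by_contra hne
    apply hx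
    refine Metric.mem_cthickening_of_dist_le x (x + t • (-u)) _ _
      (subset_tsupport _ hne) ?_
    rw [dist_eq_norm]
    simp only [smul_neg, sub_add_cancel_left, neg_neg, norm_smul, Real.norm_eq_abs,
      abs_of_nonneg ht]
    exact mul_le_of_le_one_left (norm_nonneg _) ht1
  set g : E → ℝ := Z.indicator fun x => lineDeriv ℝ G x v
  have hg : Integrable g μ := by
    refine IntegrableOn.integrable_indicator ?_ hZ.measurableSet
    exact Measure.integrableOn_of_bounded hZ.measure_ne_top
      (aestronglyMeasurable_lineDeriv hG.continuous μ) (M := D * ‖v‖)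
      (.of_forall fun _ => norm_lineDeriv_le_of_lipschitz ℝ hG)
  have h1 := hF.integral_inv_smul_sub_mul_tendsto_integral_lineDeriv_mul hg (-u)
  have h2 := hG.integral_inv_smul_sub_mul_tendsto_integral_lineDeriv_mul
    (integrable_lineDeriv (μ := μ) hF hc v) u
  have hgF : ∫ x, lineDeriv ℝ F x (-u) * g x ∂μ =
      - ∫ x, lineDeriv ℝ F x u * lineDeriv ℝ G x v ∂μ := by
    rw [← integral_neg]
    congr 1 with x
    by_cases hx : x ∈ Z
    · simp [g, hx, lineDeriv_neg]
    · have : lineDeriv ℝ F x u = 0 := by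
        have h : F =ᶠ[𝓝 x] fun _ => 0 := notMem_tsupport_iff_eventuallyEq.1 fun h =>
          hx (Metric.self_subset_cthickening _ h)
        rw [h.lineDeriv_eq]; simp [lineDeriv]
      simp [g, hx, this]
  rw [hgF] at h1
  -- The discrete version of the claim: a translation moves the difference quotient from `F` to `G`,
  -- and one integration by parts in direction `v` moves the derivative back. No second derivatives
  -- occur.
  have h3 : ∀ᶠ t : ℝ in 𝓝[>] 0, ∫ x, (t⁻¹ • (F (x + t • (-u)) - F x)) * g x ∂μ =
      - ∫ x, (t⁻¹ • (G (x + t • u) - G x)) * lineDeriv ℝ F x v ∂μ := by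
    filter_upwards [Ioc_mem_nhdsGT (zero_lt_one' ℝ)] with t ht
    have hGt : LipschitzWith D fun x => G (x + t • u) := by
      refine LipschitzWith.of_dist_le_mul fun x y => ?_
      simpa using hG.dist_le_mul (x + t • u) (y + t • u)
    have hI := (hGt.sub hG).integral_lineDeriv_mul_eq (μ := μ) hF hc v
    have hbd : ∀ (H : E → ℝ) (C' : ℝ≥0), LipschitzWith C' H → ∀ P : E → ℝ, Continuous P →
        HasCompactSupport P → Integrable (fun x => lineDeriv ℝ H x v * P x) μ := by
      intro H C' hH P hP hPc
      exact (hP.integrable_of_hasCompactSupport hPc).bdd_mul (c := C' * ‖v‖)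
        (aestronglyMeasurable_lineDeriv hH.continuous μ)
        (.of_forall fun _ => norm_lineDeriv_le_of_lipschitz ℝ hH)
    have hshift : ∀ x, lineDeriv ℝ (fun x => G (x + t • u)) x v = lineDeriv ℝ G (x + t • u) v := by
      intro x
      simp only [lineDeriv]
      congr 1 with s
      congr 1
      abel
    have hcF : HasCompactSupport fun x => F (x + t • (-u)) := by
      exact hc.comp_homeomorph (Homeomorph.addRight (t • (-u)))
    have hL : ∫ x, lineDeriv ℝ (fun x => G (x + t • u) - G x) x v * F x ∂μ =
        ∫ x, lineDeriv ℝ G x v * (F (x + t • (-u)) - F x) ∂μ := by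
      have ha : ∀ᵐ x ∂μ, lineDeriv ℝ (fun x => G (x + t • u) - G x) x v * F x =
          lineDeriv ℝ G (x + t • u) v * F x - lineDeriv ℝ G x v * F x := by
        filter_upwards [hGt.ae_lineDifferentiableAt (μ := μ) v, hG.ae_lineDifferentiableAt (μ := μ) v]
          with x hx1 hx2
        rw [← hshift, ← sub_mul]
        congr 1
        exact deriv_fun_sub hx1 hx2
      rw [integral_congr_ae ha, integral_sub]
      · have : ∫ x, lineDeriv ℝ G (x + t • u) v * F x ∂μ =
            ∫ x, lineDeriv ℝ G x v * F (x + t • (-u)) ∂μ := by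
          rw [← integral_add_right_eq_self (fun x => lineDeriv ℝ G x v * F (x + t • (-u))) (t • u)]
          congr 1 with x
          simp
        rw [this, ← integral_sub]
        · simp only [mul_sub]
        · exact hbd G D hG _ (hF.continuous.comp (by fun_prop)) hcF
        · exact hbd G D hG _ hF.continuous hc
      · simp only [← hshift]
        exact hbd _ D hGt _ hF.continuous hc
      · exact hbd G D hG _ hF.continuous hc
    have hR : ∫ x, (t⁻¹ • (F (x + t • (-u)) - F x)) * g x ∂μ =
        t⁻¹ * ∫ x, lineDeriv ℝ G x v * (F (x + t • (-u)) - F x) ∂μ := by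
      rw [← integral_const_mul]
      congr 1 with x
      by_cases hx : x ∈ Z
      · simp only [g, hx, Set.indicator_of_mem, smul_eq_mul]; ring
      · have e1 := hFZ x hx t ht.1.le ht.2
        have e2 := hFZ x hx 0 le_rfl zero_le_one
        rw [zero_smul, add_zero] at e2
        rw [e1, e2]; simp
    rw [hR, ← hL]
    have hI' : ∫ x, lineDeriv ℝ (fun x => G (x + t • u) - G x) x v * F x ∂μ =
      ∫ x, lineDeriv ℝ F x (-v) * (G (x + t • u) - G x) ∂μ := hI
    rw [hI', ← integral_const_mul, ← integral_neg]
    congr 1 with x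
    simp only [lineDeriv_neg, smul_eq_mul]
    ring
  have h4 := tendsto_nhds_unique (h1.congr' h3) h2.neg
  have h5 := neg_injective h4
  rw [h5]
  congr 1 with x
  ring

end Weak

end

/-! ### Stokes' formula on the square and null homotopies as spanning surfaces. -/

section

/-- The nearest point of `[0, 1]`. -/
noncomputable def clamp (t : ℝ) : ℝ := max 0 (min t 1)

theorem clamp_mem (t : ℝ) : clamp t ∈ Set.Icc (0 : ℝ) 1 :=
  ⟨le_max_left _ _, max_le zero_le_one (min_le_right _ _)⟩

theorem clamp_of_mem {t : ℝ} (h : t ∈ Set.Icc (0 : ℝ) 1) : clamp t = t := by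
  simp [clamp, h.1, h.2]

theorem clamp_of_nonpos {t : ℝ} (h : t ≤ 0) : clamp t = 0 := by
  simp [clamp, h]

theorem clamp_of_one_le {t : ℝ} (h : 1 ≤ t) : clamp t = 1 := by
  simp [clamp, h]

theorem lipschitzWith_clamp : LipschitzWith 1 clamp :=
  (LipschitzWith.id.min_const 1).const_max 0

/-- The nearest point of the square. -/
noncomputable def clampSq (q : ℝ × ℝ) : ℝ × ℝ := (clamp q.1, clamp q.2)

theorem clampSq_mem (q : ℝ × ℝ) : clampSq q ∈ square := ⟨clamp_mem _, clamp_mem _⟩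

theorem clampSq_of_mem {q : ℝ × ℝ} (h : q ∈ square) : clampSq q = q :=
  Prod.ext (clamp_of_mem h.1) (clamp_of_mem h.2)

theorem lipschitzWith_clampSq : LipschitzWith 1 clampSq := by
  have h := (lipschitzWith_clamp.comp LipschitzWith.prod_fst).prodMk
    (lipschitzWith_clamp.comp (LipschitzWith.prod_snd (α := ℝ) (β := ℝ)))
  simp only [mul_one, max_self] at h
  exact h

/-- The trapezoidal cutoff: `1` on `[0, 1]`, `0` outside `[-1, 2]`, affine in between. -/
noncomputable def trapezoid (t : ℝ) : ℝ := max 0 (min 1 (min (t + 1) (2 - t)))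

/-- The derivative of the trapezoidal cutoff. -/
noncomputable def trapezoidSlope (t : ℝ) : ℝ :=
  (Set.Ioo (-1) 0).indicator 1 t - (Set.Ioo 1 2).indicator 1 t

theorem lipschitzWith_trapezoid : LipschitzWith 1 trapezoid := by
  have h1 : LipschitzWith 1 fun t : ℝ => t + 1 :=
    LipschitzWith.of_dist_le_mul fun x y => by simp
  have h2 : LipschitzWith 1 fun t : ℝ => 2 - t :=
    LipschitzWith.of_dist_le_mul fun x y => by
      rw [Real.dist_eq, Real.dist_eq, abs_sub_comm x y]
      simp
  have h3 := ((h1.min h2).const_min 1).const_max 0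
  simp only [max_self] at h3
  exact h3

theorem abs_trapezoid_le (t : ℝ) : |trapezoid t| ≤ 1 := by
  rw [trapezoid, abs_of_nonneg (le_max_left _ _)]
  exact max_le zero_le_one (min_le_left _ _)

theorem trapezoid_of_mem {t : ℝ} (h : t ∈ Set.Icc (0 : ℝ) 1) : trapezoid t = 1 := by
  have h1 : 1 ≤ min (t + 1) (2 - t) := le_min (by linarith [h.1]) (by linarith [h.2])
  simp [trapezoid, min_eq_left h1]

theorem trapezoid_of_notMem {t : ℝ} (h : t ∉ Set.Icc (-1 : ℝ) 2) : trapezoid t = 0 := by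
  rw [trapezoid, max_eq_left]
  refine (min_le_right _ _).trans ?_
  by_cases h1 : t < -1
  · exact (min_le_left _ _).trans (by linarith)
  · have : 2 < t := by
      by_contra h2
      exact h ⟨not_lt.1 h1, not_lt.1 h2⟩
    exact (min_le_right _ _).trans (by linarith)

theorem hasDerivAt_trapezoid {t : ℝ} (h1 : t ≠ -1) (h2 : t ≠ 0) (h3 : t ≠ 1) (h4 : t ≠ 2) :
    HasDerivAt trapezoid (trapezoidSlope t) t := by
  rcases lt_or_gt_of_ne h1 with h1 | h1
  · have : trapezoidSlope t = 0 := by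
      simp [trapezoidSlope, Set.indicator, Set.mem_Ioo]; grind
    rw [this]
    refine (hasDerivAt_const t (0 : ℝ)).congr_of_eventuallyEq ?_
    filter_upwards [Iio_mem_nhds h1] with s hs
    exact trapezoid_of_notMem fun h => absurd h.1 (not_le.2 hs)
  rcases lt_or_gt_of_ne h2 with h2 | h2
  · have : trapezoidSlope t = 1 := by
      simp [trapezoidSlope, Set.indicator, Set.mem_Ioo]; grind
    rw [this]
    refine ((hasDerivAt_id t).add_const 1).congr_of_eventuallyEq ?_
    filter_upwards [Ioo_mem_nhds h1 h2] with s hs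
    simp only [trapezoid, id]
    rw [min_eq_left (a := s + 1), min_eq_right, max_eq_right] <;> linarith [hs.1, hs.2]
  rcases lt_or_gt_of_ne h3 with h3 | h3
  · have : trapezoidSlope t = 0 := by
      simp [trapezoidSlope, Set.indicator, Set.mem_Ioo]; grind
    rw [this]
    refine (hasDerivAt_const t (1 : ℝ)).congr_of_eventuallyEq ?_
    filter_upwards [Ioo_mem_nhds h2 h3] with s hs
    exact trapezoid_of_mem (Set.Ioo_subset_Icc_self hs)
  rcases lt_or_gt_of_ne h4 with h4 | h4
  · have : trapezoidSlope t = -1 := by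
      simp [trapezoidSlope, Set.indicator, Set.mem_Ioo]; grind
    rw [this]
    refine ((hasDerivAt_id t).const_sub 2).congr_of_eventuallyEq ?_
    filter_upwards [Ioo_mem_nhds h3 h4] with s hs
    simp only [trapezoid, id]
    rw [min_eq_right (a := s + 1), min_eq_right, max_eq_right] <;> linarith [hs.1, hs.2]
  · have : trapezoidSlope t = 0 := by
      simp [trapezoidSlope, Set.indicator, Set.mem_Ioo]; grind
    rw [this]
    refine (hasDerivAt_const t (0 : ℝ)).congr_of_eventuallyEq ?_
    filter_upwards [Ioi_mem_nhds h4] with s hs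
    exact trapezoid_of_notMem fun h => absurd h.2 (not_le.2 hs)

theorem lineDeriv_fst (G : ℝ × ℝ → ℝ) (q : ℝ × ℝ) :
    lineDeriv ℝ G q (1, 0) = deriv (fun t => G (t, q.2)) q.1 := by
  have := deriv_comp_add_const (fun t => G (t, q.2)) q.1 0
  simp only [zero_add] at this
  rw [← this]
  simp [lineDeriv, add_comm, Prod.add_def]

theorem lineDeriv_snd (G : ℝ × ℝ → ℝ) (q : ℝ × ℝ) :
    lineDeriv ℝ G q (0, 1) = deriv (fun t => G (q.1, t)) q.2 := by
  have := deriv_comp_add_const (fun t => G (q.1, t)) q.2 0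
  simp only [zero_add] at this
  rw [← this]
  simp [lineDeriv, add_comm, Prod.add_def]

theorem deriv_of_comp_clamp {g : ℝ → ℝ} (hg : ∀ t, g t = g (clamp t)) {t : ℝ}
    (ht : t ∉ Set.Icc (0 : ℝ) 1) : deriv g t = 0 := by
  rcases lt_or_ge t 0 with h | h
  · have : g =ᶠ[𝓝 t] fun _ => g 0 := by
      filter_upwards [Iio_mem_nhds h] with s hs
      rw [hg, clamp_of_nonpos (le_of_lt hs)]
    simp [this.deriv_eq]
  · have h1 : 1 < t := by
      by_contra h1
      exact ht ⟨h, not_lt.1 h1⟩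
    have : g =ᶠ[𝓝 t] fun _ => g 1 := by
      filter_upwards [Ioi_mem_nhds h1] with s hs
      rw [hg, clamp_of_one_le (le_of_lt hs)]
    simp [this.deriv_eq]

/-- The collar on the left and on the right of the square contributes the integrals over the
vertical sides. -/
theorem integral_collar {F G : ℝ × ℝ → ℝ} (hFc : ∀ q, F q = F (clampSq q))
    (hGc : ∀ q, G q = G (clampSq q)) {C D : ℝ≥0} (hF : LipschitzWith C F) (hG : LipschitzWith D G) :
    Integrable (fun q : ℝ × ℝ =>
      trapezoidSlope q.1 * trapezoid q.2 * F q * lineDeriv ℝ G q (0, 1)) ∧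
    ∫ q : ℝ × ℝ, trapezoidSlope q.1 * trapezoid q.2 * F q * lineDeriv ℝ G q (0, 1) =
      (∫ r in (0 : ℝ)..1, F (0, r) * deriv (fun s => G (0, s)) r) -
        ∫ r in (0 : ℝ)..1, F (1, r) * deriv (fun s => G (1, s)) r := by
  have key : ∀ q : ℝ × ℝ, trapezoidSlope q.1 * trapezoid q.2 * F q * lineDeriv ℝ G q (0, 1) =
      (Set.Ioo (-1 : ℝ) 0).indicator 1 q.1 *
        (Set.Icc (0 : ℝ) 1).indicator (fun r => F (0, r) * deriv (fun s => G (0, s)) r) q.2 -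
      (Set.Ioo (1 : ℝ) 2).indicator 1 q.1 *
        (Set.Icc (0 : ℝ) 1).indicator (fun r => F (1, r) * deriv (fun s => G (1, s)) r) q.2 := by
    rintro ⟨t, r⟩
    rw [lineDeriv_snd]
    simp only
    by_cases hr : r ∈ Set.Icc (0 : ℝ) 1
    · rw [trapezoid_of_mem hr, Set.indicator_of_mem hr, Set.indicator_of_mem hr]
      by_cases h1 : t ∈ Set.Ioo (-1 : ℝ) 0
      · have h2 : t ∉ Set.Ioo (1 : ℝ) 2 := fun h => by linarith [h1.2, h.1]
        have e : ∀ H : ℝ × ℝ → ℝ, (∀ q, H q = H (clampSq q)) → ∀ s, H (t, s) = H (0, s) := by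
          intro H hH s
          rw [hH, hH (0, s)]
          simp [clampSq, clamp_of_nonpos h1.2.le, clamp_of_nonpos le_rfl]
        simp [trapezoidSlope, h1, h2, e F hFc, e G hGc]
      · by_cases h2 : t ∈ Set.Ioo (1 : ℝ) 2
        · have e : ∀ H : ℝ × ℝ → ℝ, (∀ q, H q = H (clampSq q)) → ∀ s, H (t, s) = H (1, s) := by
            intro H hH s
            rw [hH, hH (1, s)]
            simp [clampSq, clamp_of_one_le h2.1.le, clamp_of_one_le le_rfl]
          simp [trapezoidSlope, h1, h2, e F hFc, e G hGc]
        · simp [trapezoidSlope, h1, h2]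
    · rw [deriv_of_comp_clamp (g := fun s => G (t, s)) _ hr]
      · simp [hr]
      · intro s
        rw [hGc, hGc (t, clamp s)]
        simp [clampSq, clamp_of_mem (clamp_mem s)]
  have hint : ∀ a : ℝ, Integrable
      ((Set.Icc (0 : ℝ) 1).indicator (fun r => F (a, r) * deriv (fun s => G (a, s)) r)) := by
    intro a
    refine IntegrableOn.integrable_indicator ?_ measurableSet_Icc
    have hFa : Continuous fun r => F (a, r) := hF.continuous.comp (by fun_prop)
    have hGa : LipschitzWith D fun r => G (a, r) :=
      LipschitzWith.of_dist_le_mul fun x y => by simpa [Prod.dist_eq] using hG.dist_le_mul (a, x) (a, y)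
    have h1 : IntegrableOn (fun r => F (a, r)) (Set.Icc 0 1) :=
      hFa.continuousOn.integrableOn_compact isCompact_Icc
    refine h1.mul_bdd (c := D) (stronglyMeasurable_deriv _).aestronglyMeasurable
      (.of_forall fun r => norm_deriv_le_of_lipschitz hGa)
  have hind : ∀ a b : ℝ, Integrable ((Set.Ioo a b).indicator (1 : ℝ → ℝ)) := fun a b =>
    (integrable_indicator_iff measurableSet_Ioo).2 (by simp [Pi.one_def])
  simp_rw [key]
  refine ⟨((hind _ _).mul_prod (hint 0)).sub ((hind _ _).mul_prod (hint 1)), ?_⟩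
  rw [integral_sub, Measure.volume_eq_prod, integral_prod_mul, integral_prod_mul,
    integral_indicator measurableSet_Ioo, integral_indicator measurableSet_Ioo,
    integral_indicator measurableSet_Icc, integral_indicator measurableSet_Icc,
    intervalIntegral.integral_of_le zero_le_one, intervalIntegral.integral_of_le zero_le_one,
    integral_Icc_eq_integral_Ioc, integral_Icc_eq_integral_Ioc]
  · simp only [Pi.one_def, integral_const, measureReal_restrict_apply_univ, Real.volume_real_Ioo]
    norm_num
  · exact (hind _ _).mul_prod (hint 0)
  · exact (hind _ _).mul_prod (hint 1)


theorem lineDeriv_fst_eq_zero {G : ℝ × ℝ → ℝ} (hG : ∀ q, G q = G (clampSq q)) {q : ℝ × ℝ}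
    (hq : q.1 ∉ Set.Icc (0 : ℝ) 1) : lineDeriv ℝ G q (1, 0) = 0 := by
  rw [lineDeriv_fst]
  refine deriv_of_comp_clamp (fun t => ?_) hq
  rw [hG, hG (clamp t, _)]
  simp [clampSq, clamp_of_mem (clamp_mem t)]

theorem lineDeriv_snd_eq_zero {G : ℝ × ℝ → ℝ} (hG : ∀ q, G q = G (clampSq q)) {q : ℝ × ℝ}
    (hq : q.2 ∉ Set.Icc (0 : ℝ) 1) : lineDeriv ℝ G q (0, 1) = 0 := by
  rw [lineDeriv_snd]
  refine deriv_of_comp_clamp (fun t => ?_) hq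
  rw [hG, hG (_, clamp t)]
  simp [clampSq, clamp_of_mem (clamp_mem t)]

theorem ae_hasDerivAt_trapezoid : ∀ᵐ t : ℝ, HasDerivAt trapezoid (trapezoidSlope t) t := by
  have h : ∀ a : ℝ, ∀ᵐ t : ℝ, t ≠ a := fun a => by simp [ae_iff]
  filter_upwards [h (-1), h 0, h 1, h 2] with t h1 h2 h3 h4
  exact hasDerivAt_trapezoid h1 h2 h3 h4

theorem lipschitzWith_comp_swap {F : ℝ × ℝ → ℝ} {C : ℝ≥0} (hF : LipschitzWith C F) :
    LipschitzWith C fun q : ℝ × ℝ => F q.swap :=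
  LipschitzWith.of_dist_le_mul fun x y => by
    have := hF.dist_le_mul x.swap y.swap
    rwa [Prod.dist_eq, Prod.fst_swap, Prod.fst_swap, Prod.snd_swap, Prod.snd_swap, max_comm,
      ← Prod.dist_eq] at this

/-- With `χ` a product of trapezoids, `d(χF) ∧ dG` has integral zero over the plane. Clamped
functions do not vary across the collars, so `χ dF ∧ dG` vanishes outside the square, while the
terms with `dχ` live on four collars of width one and give the side integrals. -/
theorem stokes_of_clamp {F G : ℝ × ℝ → ℝ} (hFc : ∀ q, F q = F (clampSq q))
    (hGc : ∀ q, G q = G (clampSq q)) {C D : ℝ≥0} (hF : LipschitzWith C F) (hG : LipschitzWith D G) :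
    ∫ q in square, (lineDeriv ℝ F q (1, 0) * lineDeriv ℝ G q (0, 1) -
        lineDeriv ℝ F q (0, 1) * lineDeriv ℝ G q (1, 0)) =
      ((∫ t in (0 : ℝ)..1, F (t, 0) * deriv (fun s => G (s, 0)) t) -
        ∫ t in (0 : ℝ)..1, F (t, 1) * deriv (fun s => G (s, 1)) t) -
      ((∫ r in (0 : ℝ)..1, F (0, r) * deriv (fun s => G (0, s)) r) -
        ∫ r in (0 : ℝ)..1, F (1, r) * deriv (fun s => G (1, s)) r) := by
  have hsq : IsCompact square := isCompact_Icc.prod isCompact_Icc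
  obtain ⟨M, hM⟩ := hsq.exists_bound_of_continuousOn hF.continuous.continuousOn
  have hFb : ∀ q, |F q| ≤ (M.toNNReal : ℝ) := fun q => by
    rw [hFc]
    exact (hM _ (clampSq_mem q)).trans (Real.le_coe_toNNReal M)
  set χ : ℝ × ℝ → ℝ := fun q => trapezoid q.1 * trapezoid q.2
  have h1 : LipschitzWith 1 fun q : ℝ × ℝ => trapezoid q.1 := by
    have h := lipschitzWith_trapezoid.comp (LipschitzWith.prod_fst (α := ℝ) (β := ℝ))
    rw [mul_one] at h
    exact h
  have h2 : LipschitzWith 1 fun q : ℝ × ℝ => trapezoid q.2 := by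
    have h := lipschitzWith_trapezoid.comp (LipschitzWith.prod_snd (α := ℝ) (β := ℝ))
    rw [mul_one] at h
    exact h
  have hχ := lipschitzWith_mul_of_bounded (A := 1) (B := 1) h1 h2
    (fun q => abs_trapezoid_le _) (fun q => abs_trapezoid_le _)
  have hχb : ∀ q, |χ q| ≤ ((1 : ℝ≥0) : ℝ) := fun q => by
    simp only [χ, abs_mul, NNReal.coe_one]
    exact mul_le_one₀ (abs_trapezoid_le _) (abs_nonneg _) (abs_trapezoid_le _)
  have hχF := lipschitzWith_mul_of_bounded hχ hF hχb hFb
  have hsupp : HasCompactSupport fun q => χ q * F q := by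
    refine HasCompactSupport.of_support_subset_isCompact
      ((isCompact_Icc (a := (-1 : ℝ)) (b := 2)).prod (isCompact_Icc (a := (-1 : ℝ)) (b := 2)))
      fun q hq => ?_
    by_contra hq'
    apply hq
    rw [Set.mem_prod, not_and_or] at hq'
    rcases hq' with h | h <;> simp [χ, trapezoid_of_notMem h]
  have hweak := integral_lineDeriv_mul_lineDeriv_comm (μ := volume) hχF hG hsupp (1, 0) (0, 1)
  have hprod : ∀ q : ℝ × ℝ, HasDerivAt trapezoid (trapezoidSlope q.1) q.1 →
      HasDerivAt trapezoid (trapezoidSlope q.2) q.2 → DifferentiableAt ℝ F q →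
      lineDeriv ℝ (fun q => χ q * F q) q (1, 0) =
        trapezoidSlope q.1 * trapezoid q.2 * F q + χ q * lineDeriv ℝ F q (1, 0) ∧
      lineDeriv ℝ (fun q => χ q * F q) q (0, 1) =
        trapezoidSlope q.2 * trapezoid q.1 * F q + χ q * lineDeriv ℝ F q (0, 1) := by
    intro q ha hb hFq
    have d1 : HasDerivAt (fun t => F (t, q.2)) (lineDeriv ℝ F q (1, 0)) q.1 := by
      rw [lineDeriv_fst]
      have : DifferentiableAt ℝ (fun t => F (t, q.2)) q.1 :=
        DifferentiableAt.comp (g := F) (f := fun t : ℝ => (t, q.2)) q.1 hFq (by fun_prop)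
      exact this.hasDerivAt
    have d2 : HasDerivAt (fun t => F (q.1, t)) (lineDeriv ℝ F q (0, 1)) q.2 := by
      rw [lineDeriv_snd]
      have : DifferentiableAt ℝ (fun t => F (q.1, t)) q.2 :=
        DifferentiableAt.comp (g := F) (f := fun t : ℝ => (q.1, t)) q.2 hFq (by fun_prop)
      exact this.hasDerivAt
    constructor
    · rw [lineDeriv_fst, ((ha.mul_const (trapezoid q.2)).fun_mul d1).deriv]
    · rw [lineDeriv_snd, ((hb.const_mul (trapezoid q.1)).fun_mul d2).deriv]
      simp only [χ]
      ring
  have hae : ∀ᵐ q : ℝ × ℝ, HasDerivAt trapezoid (trapezoidSlope q.1) q.1 ∧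
      HasDerivAt trapezoid (trapezoidSlope q.2) q.2 ∧ DifferentiableAt ℝ F q := by
    have e1 : ∀ᵐ q : ℝ × ℝ, HasDerivAt trapezoid (trapezoidSlope q.1) q.1 :=
      Measure.quasiMeasurePreserving_fst.ae ae_hasDerivAt_trapezoid
    have e2 : ∀ᵐ q : ℝ × ℝ, HasDerivAt trapezoid (trapezoidSlope q.2) q.2 :=
      Measure.quasiMeasurePreserving_snd.ae ae_hasDerivAt_trapezoid
    filter_upwards [e1, e2, hF.ae_differentiableAt] with q a b c using ⟨a, b, c⟩
  have hc1 := integral_collar hFc hGc hF hG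
  have hc2 := integral_collar (F := fun q => F q.swap) (G := fun q => G q.swap)
    (fun q => hFc q.swap) (fun q => hGc q.swap) (lipschitzWith_comp_swap hF)
    (lipschitzWith_comp_swap hG)
  have hswap : (fun q : ℝ × ℝ => trapezoidSlope q.1 * trapezoid q.2 * F q.swap *
      lineDeriv ℝ (fun q => G q.swap) q (0, 1)) = fun q : ℝ × ℝ =>
      (fun p : ℝ × ℝ => trapezoidSlope p.2 * trapezoid p.1 * F p * lineDeriv ℝ G p (1, 0))
        q.swap := by
    ext q
    simp only [lineDeriv_snd, lineDeriv_fst, Prod.fst_swap, Prod.snd_swap, Prod.swap_prod_mk]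
  rw [hswap, Measure.volume_eq_prod] at hc2
  have hc2i : Integrable fun p : ℝ × ℝ =>
      trapezoidSlope p.2 * trapezoid p.1 * F p * lineDeriv ℝ G p (1, 0) := hc2.1.swap
  have hc2e := (integral_prod_swap (μ := volume) (ν := volume)
    fun p : ℝ × ℝ => trapezoidSlope p.2 * trapezoid p.1 * F p * lineDeriv ℝ G p (1, 0)).symm.trans
      hc2.2
  simp only [Prod.swap_prod_mk] at hc2e
  have hi : ∀ v w : ℝ × ℝ, Integrable fun q =>
      lineDeriv ℝ (fun q => χ q * F q) q v * lineDeriv ℝ G q w := fun v w =>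
    (integrable_lineDeriv hχF hsupp v).mul_bdd (c := D * ‖w‖)
      (aestronglyMeasurable_lineDeriv hG.continuous _)
      (.of_forall fun _ => norm_lineDeriv_le_of_lipschitz ℝ hG)
  have hfin : ∀ᵐ q : ℝ × ℝ, square.indicator (fun q => lineDeriv ℝ F q (1, 0) *
      lineDeriv ℝ G q (0, 1) - lineDeriv ℝ F q (0, 1) * lineDeriv ℝ G q (1, 0)) q =
      (lineDeriv ℝ (fun q => χ q * F q) q (1, 0) * lineDeriv ℝ G q (0, 1) -
        trapezoidSlope q.1 * trapezoid q.2 * F q * lineDeriv ℝ G q (0, 1)) -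
      (lineDeriv ℝ (fun q => χ q * F q) q (0, 1) * lineDeriv ℝ G q (1, 0) -
        trapezoidSlope q.2 * trapezoid q.1 * F q * lineDeriv ℝ G q (1, 0)) := by
    filter_upwards [hae] with q ⟨a, b, c⟩
    obtain ⟨p1, p2⟩ := hprod q a b c
    rw [p1, p2]
    by_cases hq : q ∈ square
    · simp only [hq, Set.indicator_of_mem, χ, trapezoid_of_mem hq.1, trapezoid_of_mem hq.2]
      ring
    · rw [Set.indicator_of_notMem hq]
      rw [square, Set.mem_prod, not_and_or] at hq
      rcases hq with h | h
      · simp [lineDeriv_fst_eq_zero hFc h, lineDeriv_fst_eq_zero hGc h]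
      · simp [lineDeriv_snd_eq_zero hFc h, lineDeriv_snd_eq_zero hGc h]
  have hsplit : ∀ a b c d : ℝ × ℝ → ℝ, Integrable a → Integrable b → Integrable c → Integrable d →
      ∫ q, (a q - b q - (c q - d q)) = ((∫ q, a q) - ∫ q, b q) - ((∫ q, c q) - ∫ q, d q) := by
    intro a b c d ha hb hc hd
    rw [← integral_sub ha hb, ← integral_sub hc hd]
    exact integral_sub (ha.sub hb) (hc.sub hd)
  rw [← integral_indicator hsq.measurableSet, integral_congr_ae hfin,
    hsplit _ _ _ _ (hi (1, 0) (0, 1)) hc1.1 (hi (0, 1) (1, 0)) hc2i, hc1.2]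
  rw [← Measure.volume_eq_prod] at hc2e
  linarith

theorem ae_square_mem_nhds : ∀ᵐ q : ℝ × ℝ, q ∈ square → square ∈ 𝓝 q := by
  have h : ∀ a : ℝ, ∀ᵐ t : ℝ, t ≠ a := fun a => by simp [ae_iff]
  have h' : ∀ᵐ t : ℝ, t ≠ 0 ∧ t ≠ 1 := (h 0).and (h 1)
  have e1 : ∀ᵐ q : ℝ × ℝ, q.1 ≠ 0 ∧ q.1 ≠ 1 := Measure.quasiMeasurePreserving_fst.ae h'
  have e2 : ∀ᵐ q : ℝ × ℝ, q.2 ≠ 0 ∧ q.2 ≠ 1 := Measure.quasiMeasurePreserving_snd.ae h'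
  filter_upwards [e1, e2] with q a b hq
  exact prod_mem_nhds
    (Icc_mem_nhds (lt_of_le_of_ne hq.1.1 a.1.symm) (lt_of_le_of_ne hq.1.2 a.2))
    (Icc_mem_nhds (lt_of_le_of_ne hq.2.1 b.1.symm) (lt_of_le_of_ne hq.2.2 b.2))

theorem measurableSet_square : MeasurableSet square := measurableSet_Icc.prod measurableSet_Icc

variable {n : ℕ} [NeZero n] {K : Set (EuclideanSpace ℝ (Fin 2))} {I : Set ℝ}

/-- The surface consisting of a single patch. -/
def Surface.single (Φ : ℝ × ℝ → ConeProduct n K I) (h : ∃ C : ℝ≥0, LipschitzOnWith C Φ square) :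
    Surface n K I where
  size := 1
  mult _ := 1
  patch _ := Φ
  lipschitz _ := h

/-- A Lipschitz null homotopy of a closed curve is a surface bounded by the curve. -/
theorem Surface.hasBoundary_single {Φ : ℝ × ℝ → ConeProduct n K I}
    (h : ∃ C : ℝ≥0, LipschitzOnWith C Φ square) {γ : ℝ → ConeProduct n K I} {p : ConeProduct n K I}
    (h0 : ∀ t ∈ Set.Icc (0 : ℝ) 1, Φ (t, 0) = γ t) (h1 : ∀ t ∈ Set.Icc (0 : ℝ) 1, Φ (t, 1) = p)
    (hs : ∀ r ∈ Set.Icc (0 : ℝ) 1, Φ (0, r) = Φ (1, r)) : (Surface.single Φ h).HasBoundary γ := by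
  rintro f g ⟨Cf, hf⟩ ⟨Cg, hg⟩
  obtain ⟨C, hC⟩ := h
  -- The patch is controlled only on the square; precomposing with the nearest point map gives
  -- functions Lipschitz on the whole plane, with unchanged differentials in the interior.
  set ext : (ConeProduct n K I → ℝ) → ℝ × ℝ → ℝ := fun f q => f (Φ (clampSq q)) with hext
  have hlip : ∀ (f : ConeProduct n K I → ℝ) (Cf : ℝ≥0), LipschitzWith Cf f →
      LipschitzWith (Cf * C * 1) (ext f) := by
    intro f Cf hf
    rw [← lipschitzOnWith_univ]
    exact (hf.comp_lipschitzOnWith hC).comp lipschitzWith_clampSq.lipschitzOnWith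
      fun q _ => clampSq_mem q
  have hcl : ∀ (f : ConeProduct n K I → ℝ) q, ext f q = ext f (clampSq q) := fun f q => by
    simp only [ext, clampSq_of_mem (clampSq_mem q)]
  have hst := stokes_of_clamp (hcl f) (hcl g) (hlip f Cf hf) (hlip g Cg hg)
  have hfd : ∀ f : ConeProduct n K I → ℝ, ∀ q : ℝ × ℝ, square ∈ 𝓝 q →
      DifferentiableAt ℝ (ext f) q → ∀ v, lineDeriv ℝ (ext f) q v = fderiv ℝ (f ∘ Φ) q v := by
    intro f q hq hd v
    have he : ext f =ᶠ[𝓝 q] f ∘ Φ := by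
      filter_upwards [hq] with p hp
      simp [ext, clampSq_of_mem hp]
    rw [hd.lineDeriv_eq_fderiv, he.fderiv_eq]
  have hsum : ∀ a : Fin 1 → ℝ, ∑ i : Fin 1, ((1 : ℤ) : ℝ) * a i = a 0 := by simp
  refine (hsum _).trans ?_
  simp only [Surface.single]
  have hL : ∫ q in square, (fderiv ℝ (f ∘ Φ) q (1, 0) * fderiv ℝ (g ∘ Φ) q (0, 1) -
      fderiv ℝ (f ∘ Φ) q (0, 1) * fderiv ℝ (g ∘ Φ) q (1, 0)) =
      ∫ q in square, (lineDeriv ℝ (ext f) q (1, 0) * lineDeriv ℝ (ext g) q (0, 1) -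
        lineDeriv ℝ (ext f) q (0, 1) * lineDeriv ℝ (ext g) q (1, 0)) := by
    refine setIntegral_congr_ae measurableSet_square ?_
    filter_upwards [ae_square_mem_nhds, (hlip f Cf hf).ae_differentiableAt,
      (hlip g Cg hg).ae_differentiableAt] with q hq hfq hgq hqs
    simp only [hfd f q (hq hqs) hfq, hfd g q (hq hqs) hgq]
  rw [hL, hst]
  have hz : (0 : ℝ) ∈ Set.Icc (0 : ℝ) 1 := ⟨le_rfl, zero_le_one⟩
  have ho : (1 : ℝ) ∈ Set.Icc (0 : ℝ) 1 := ⟨zero_le_one, le_rfl⟩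
  have htop : ∀ s, ext g (s, 1) = g p := fun s => by
    simp only [ext, clampSq, clamp_of_mem ho, h1 _ (clamp_mem s)]
  have hside : ∀ (f : ConeProduct n K I → ℝ) r, ext f (0, r) = ext f (1, r) := fun f r => by
    simp only [ext, clampSq, clamp_of_mem ho, clamp_of_mem hz, hs _ (clamp_mem r)]
  -- The top side is constant and the vertical sides cancel; the bottom side is `γ`.
  simp only [htop, hside, deriv_const, mul_zero, intervalIntegral.integral_zero, sub_self, sub_zero]
  refine intervalIntegral.integral_congr_ae ?_
  have hne : ∀ᵐ t : ℝ, t ≠ 1 := by simp [ae_iff]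
  filter_upwards [hne] with t ht1 ht
  rw [Set.uIoc_of_le zero_le_one] at ht
  have hf0 : ext f (t, 0) = f (γ t) := by
    simp only [ext, clampSq_of_mem (show (t, (0 : ℝ)) ∈ square from ⟨⟨ht.1.le, ht.2⟩, hz⟩),
      h0 t ⟨ht.1.le, ht.2⟩]
  have hg0 : (fun s => ext g (s, 0)) =ᶠ[𝓝 t] g ∘ γ := by
    filter_upwards [Icc_mem_nhds ht.1 (lt_of_le_of_ne ht.2 ht1)] with s hs
    simp only [ext, clampSq_of_mem (show (s, (0 : ℝ)) ∈ square from ⟨hs, hz⟩), h0 s hs,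
      Function.comp]
  rw [hf0, hg0.deriv_eq]

end

section

variable {n : ℕ} {K : Set (EuclideanSpace ℝ (Fin 2))} {I : Set ℝ}

/-! ### Half spaces of the cone product -/

variable (K I) in
/-- The solid `K × I`. -/
def solid : Set E3 := {p | !₂[p 0, p 1] ∈ K ∧ p 2 ∈ I}

theorem convex_solid (hK : Convex ℝ K) (hI : I.OrdConnected) : Convex ℝ (solid K I) := by
  intro p hp q hq a b ha hb hab
  refine ⟨?_, ?_⟩
  · have h := hK hp.1 hq.1 ha hb hab
    convert h using 1
    ext i
    fin_cases i <;> simp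
  · have h := hI.convex hp.2 hq.2 ha hb hab
    simpa using h

theorem CutPoint.pos_mem_solid (a : CutPoint n K I) : a.pos ∈ solid K I :=
  ⟨a.horizontal_mem, a.vertical_mem⟩

theorem inner_eq_sum (u v : E3) : inner ℝ u v = u 0 * v 0 + u 1 * v 1 + u 2 * v 2 := by
  simp [PiLp.inner_apply, Fin.sum_univ_three]
  ring

variable [NeZero n]

/-- The half space containing a point, among the `2n` components of `⟨e, ·⟩ ≠ 0`, where `e` is
horizontal with nonnegative first coordinate. -/
noncomputable def CutPoint.sheet (e : E3) (a : CutPoint n K I) : Fin n × Bool :=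
  open Classical in
  -- For `0 ≤ e 0`, `e 2 = 0` the slit lies in `⟨e, ·⟩ ≥ 0` and the uncut half plane in `⟨e, ·⟩ ≤
  -- 0`. So a positive half space joins upper points of one copy to lower points of the next, while
  -- a negative one stays in its copy.
  (if a.upper = false ∧ 0 < inner ℝ e a.pos then a.copy - 1 else a.copy, decide (0 < inner ℝ e a.pos))

/-- Functions on the half spaces which are small near the walls `⟨e, ·⟩ = 0` combine to a Lipschitz
function. -/
theorem BrokenPath.edist_glue_le {e : E3} (he0 : 0 ≤ e 0) (he2 : e 2 = 0) {C D : ℝ≥0}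
    {G : Fin n × Bool → E3 → ℝ} (hG : ∀ j, LipschitzWith C (G j))
    (hD : ∀ j p, |G j p| ≤ D * |inner ℝ e p|) (hC : D * ‖e‖₊ ≤ C) {a b : CutPoint n K I} {l : ℝ≥0∞}
    (h : BrokenPath a b l) : edist (G (a.sheet e) a.pos) (G (b.sheet e) b.pos) ≤ C * l := by
  induction h with
  | segment a b hc hu =>
    by_cases hs : a.sheet e = b.sheet e
    · rw [hs]; exact hG _ _ _
    · have hne : ¬ (0 < inner ℝ e a.pos ↔ 0 < inner ℝ e b.pos) := fun h => hs (by
        simp only [CutPoint.sheet, hc, hu, h])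
      -- A segment that changes sheet within one half of a copy crosses the wall, so the two values
      -- of `|⟨e, ·⟩|` add up.
      have habs : |inner ℝ e a.pos| + |inner ℝ e b.pos| = |inner ℝ e (a.pos - b.pos)| := by
        rw [inner_sub_right]
        by_cases h1 : 0 < inner ℝ e a.pos
        · have h2 : inner ℝ e b.pos ≤ 0 := not_lt.1 fun h2 => hne ⟨fun _ => h2, fun _ => h1⟩
          rw [abs_of_pos h1, abs_of_nonpos h2, abs_of_pos (by linarith)]
          ring
        · have h2 : 0 < inner ℝ e b.pos := by
            by_contra h2
            exact hne ⟨fun h => absurd h h1, fun h => absurd h h2⟩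
          rw [abs_of_nonpos (not_lt.1 h1), abs_of_pos h2, abs_of_neg (by linarith)]
          ring
      have hC' : (D : ℝ) * ‖e‖ ≤ C := by exact_mod_cast hC
      rw [edist_dist, edist_dist, ← ENNReal.ofReal_coe_nnreal, ← ENNReal.ofReal_mul C.coe_nonneg]
      refine ENNReal.ofReal_le_ofReal ?_
      rw [Real.dist_eq, dist_eq_norm]
      calc |G (a.sheet e) a.pos - G (b.sheet e) b.pos|
          ≤ |G (a.sheet e) a.pos| + |G (b.sheet e) b.pos| := abs_sub _ _
        _ ≤ D * |inner ℝ e a.pos| + D * |inner ℝ e b.pos| := add_le_add (hD _ _) (hD _ _)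
        _ = D * |inner ℝ e (a.pos - b.pos)| := by rw [← mul_add, habs]
        _ ≤ D * (‖e‖ * ‖a.pos - b.pos‖) := by
          gcongr
          exact abs_real_inner_le_norm _ _
        _ ≤ C * ‖a.pos - b.pos‖ := by
          rw [← mul_assoc]
          gcongr
  | inCopy a b h =>
    obtain ⟨hp, hc, h1, h0⟩ := h
    have hle : ¬ 0 < inner ℝ e b.pos := by
      rw [← hp, inner_eq_sum, he2, h1]
      have := mul_nonpos_of_nonneg_of_nonpos he0 h0
      linarith
    have : a.sheet e = b.sheet e := by
      simp [CutPoint.sheet, hp, hc, hle]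
    rw [this, hp]
    simp
  | toNext a b h =>
    obtain ⟨hp, hau, hbu, hc, h1, h0⟩ := h
    have hge : 0 ≤ inner ℝ e b.pos := by
      rw [← hp, inner_eq_sum, he2, h1]
      have := mul_nonneg he0 h0
      linarith
    -- On the wall the two sides of the slit may carry different sheets, but every `G j` vanishes
    -- there.
    rcases hge.eq_or_lt with h | h
    · have hz : ∀ j, G j b.pos = 0 := fun j => by
        have := hD j b.pos
        rw [← h] at this
        simpa using this
      rw [hp, hz, hz]
      simp
    · have : a.sheet e = b.sheet e := by
        simp [CutPoint.sheet, hp, hc, hau, hbu, h]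
      rw [this, hp]
      simp
  | symm h ih => rwa [edist_comm]
  | trans h h' ih ih' =>
    rw [mul_add]
    exact (edist_triangle _ _ _).trans (add_le_add ih ih')

theorem CutPoint.le_mul_edist {a b : CutPoint n K I} {d : ℝ≥0∞} {C : ℝ≥0} (hC : C ≠ 0)
    (h : ∀ l, BrokenPath a b l → d ≤ C * l) : d ≤ C * edist a b := by
  have hC' : (C : ℝ≥0∞) ≠ 0 := by exact_mod_cast hC
  rw [mul_comm, ← ENNReal.div_le_iff hC' ENNReal.coe_ne_top]
  refine le_sInf fun l hl => ?_
  rw [ENNReal.div_le_iff hC' ENNReal.coe_ne_top, mul_comm]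
  exact h l hl

/-- Within an open half space the length metric is the Euclidean one. -/
theorem CutPoint.edist_le_of_sheet_eq (hK : Convex ℝ K) (hI : I.OrdConnected) {e : E3}
    (he0 : 0 ≤ e 0) (he2 : e 2 = 0) {a b : CutPoint n K I} (hs : a.sheet e = b.sheet e)
    (ha : inner ℝ e a.pos ≠ 0) (hb : inner ℝ e b.pos ≠ 0) : edist a b ≤ edist a.pos b.pos := by
  wlog hu : a.upper = true ∨ a.upper = b.upper generalizing a b
  · rw [edist_comm a b, edist_comm a.pos]
    refine this hs.symm hb ha ?_
    cases h : a.upper <;> cases h' : b.upper <;> simp_all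
  have hiff : 0 < inner ℝ e a.pos ↔ 0 < inner ℝ e b.pos := by
    have := congrArg Prod.snd hs
    simpa [CutPoint.sheet] using this
  have hs1 := congrArg Prod.fst hs
  simp only [CutPoint.sheet, hiff] at hs1
  by_cases hab : a.upper = b.upper
  · refine sInf_le (BrokenPath.segment a b ?_ hab)
    rw [hab] at hs1
    split_ifs at hs1
    · exact sub_left_injective hs1
    · exact hs1
  have hau : a.upper = true := hu.resolve_right hab
  have hbu : b.upper = false := by rw [hau] at hab; simpa using hab
  have hay : 0 ≤ a.pos 1 := by simpa [hau] using a.side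
  have hby : b.pos 1 ≤ 0 := by simpa [hbu] using b.side
  -- The segment meets `y = 0` at a point `c`, where `⟨e, c⟩ = e 0 * c 0` has the common sign of the
  -- end values. This sign decides whether `c` is on the slit or on the uncut half plane, and
  -- equality of sheets gives the matching passage between the copies.
  obtain ⟨θ, hθ, hθ1⟩ : ∃ θ ∈ Set.Icc (0 : ℝ) 1, (1 - θ) * a.pos 1 + θ * b.pos 1 = 0 := by
    have hc : ContinuousOn (fun θ : ℝ => (1 - θ) * a.pos 1 + θ * b.pos 1) (Set.Icc 0 1) := by
      fun_prop
    have := intermediate_value_Icc' zero_le_one hc (show (0 : ℝ) ∈ _ by simpa using ⟨hby, hay⟩)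
    exact this
  set c : E3 := (1 - θ) • a.pos + θ • b.pos with hcdef
  have hcs : c ∈ solid K I := convex_solid hK hI a.pos_mem_solid b.pos_mem_solid
    (by linarith [hθ.2]) hθ.1 (by ring)
  have hc1 : c 1 = 0 := by simpa [c] using hθ1
  have hce : inner ℝ e c = (1 - θ) * inner ℝ e a.pos + θ * inner ℝ e b.pos := by
    simp [c, inner_add_right, inner_smul_right]
  have hce' : inner ℝ e c = e 0 * c 0 := by rw [inner_eq_sum, hc1, he2]; ring
  have hdist : edist a.pos c + edist c b.pos = edist a.pos b.pos := by
    have h1 : ‖a.pos - c‖ = θ * ‖a.pos - b.pos‖ := by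
      have : a.pos - c = θ • (a.pos - b.pos) := by simp only [c]; module
      rw [this, norm_smul, Real.norm_of_nonneg hθ.1]
    have h2 : ‖c - b.pos‖ = (1 - θ) * ‖a.pos - b.pos‖ := by
      have : c - b.pos = (1 - θ) • (a.pos - b.pos) := by simp only [c]; module
      rw [this, norm_smul, Real.norm_of_nonneg (by linarith [hθ.2])]
    rw [edist_dist, edist_dist, edist_dist, ← ENNReal.ofReal_add dist_nonneg dist_nonneg,
      dist_eq_norm, dist_eq_norm, dist_eq_norm, h1, h2]
    congr 1
    ring
  let cu : CutPoint n K I := ⟨a.copy, true, c, hcs.1, hcs.2, by simp [hc1]⟩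
  let cl : CutPoint n K I := ⟨b.copy, false, c, hcs.1, hcs.2, by simp [hc1]⟩
  have hglue : BrokenPath cu cl 0 := by
    by_cases hpos : 0 < inner ℝ e b.pos
    · refine BrokenPath.toNext cu cl ⟨rfl, rfl, rfl, ?_, hc1, ?_⟩
      · simp [hau, hbu, hpos] at hs1
        simp [cu, cl, hs1]
      · have : 0 < e 0 * c 0 := by
          rw [← hce', hce]
          have hpa := hiff.2 hpos
          rcases hθ.1.eq_or_lt with h | h
          · rw [← h]; linarith
          · have := mul_pos h hpos
            have := mul_nonneg (sub_nonneg.2 hθ.2) hpa.le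
            linarith
        exact (pos_of_mul_pos_right this he0).le
    · refine BrokenPath.inCopy cu cl ⟨rfl, ?_, hc1, ?_⟩
      · simpa [hau, hbu, hpos] using hs1
      · have hna : inner ℝ e a.pos < 0 :=
          lt_of_le_of_ne (not_lt.1 fun h => hpos (hiff.1 h)) ha
        have hnb : inner ℝ e b.pos < 0 := lt_of_le_of_ne (not_lt.1 hpos) hb
        have : e 0 * c 0 < 0 := by
          rw [← hce', hce]
          rcases hθ.1.eq_or_lt with h | h
          · rw [← h]; linarith
          · have := mul_neg_of_pos_of_neg h hnb
            have := mul_nonpos_of_nonneg_of_nonpos (sub_nonneg.2 hθ.2) hna.le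
            linarith
        by_contra h
        exact absurd this (not_lt.2 (mul_nonneg he0 (not_le.1 h).le))
  have hpath := ((BrokenPath.segment a cu rfl hau).trans hglue).trans
    (BrokenPath.segment cl b rfl hbu.symm)
  refine (sInf_le hpath).trans (le_of_eq ?_)
  rw [add_zero]
  exact hdist

/-! ### The same on the quotient -/

/-- The half space containing a point of the cone product (off the walls). -/
noncomputable def sheet (e : E3) (x : ConeProduct n K I) : Fin n × Bool :=
  (Quotient.out x : CutPoint n K I).sheet e

theorem mk_out (x : ConeProduct n K I) :
    SeparationQuotient.mk (Quotient.out x : CutPoint n K I) = x := Quotient.out_eq x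

theorem dev_mk (a : CutPoint n K I) : dev (SeparationQuotient.mk a) = a.pos := rfl

theorem pos_out (x : ConeProduct n K I) : (Quotient.out x : CutPoint n K I).pos = dev x := by
  rw [← dev_mk, mk_out]

theorem edist_out (x y : ConeProduct n K I) :
    edist (Quotient.out x : CutPoint n K I) (Quotient.out y) = edist x y := by
  rw [← SeparationQuotient.edist_mk, mk_out, mk_out]

theorem lipschitzWith_dev : LipschitzWith 1 (dev : ConeProduct n K I → E3) := by
  intro x y
  rw [← edist_out, ← pos_out, ← pos_out, ENNReal.coe_one, one_mul]
  exact CutPoint.edist_pos_le _ _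

theorem dev_mem_solid (x : ConeProduct n K I) : dev x ∈ solid K I := by
  rw [← pos_out]
  exact CutPoint.pos_mem_solid _

theorem lipschitzWith_inner_right (w : E3) : LipschitzWith ‖w‖₊ fun p : E3 => inner ℝ w p :=
  LipschitzWith.of_dist_le_mul fun p q => by
    rw [Real.dist_eq, dist_eq_norm, ← inner_sub_right]
    exact abs_real_inner_le_norm _ _

theorem lipschitzWith_ite_inner (e : E3) (P : Prop) [Decidable P] :
    LipschitzWith ‖e‖₊ fun p : E3 => if P then inner ℝ e p else (0 : ℝ) := by
  by_cases h : P
  · simpa only [h, if_true] using lipschitzWith_inner_right e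
  · simpa only [h, if_false] using (LipschitzWith.const (0 : ℝ)).weaken zero_le

theorem lipschitzWith_inner_dev (w : E3) :
    LipschitzWith ‖w‖₊ fun x : ConeProduct n K I => inner ℝ w (dev x) := by
  simpa [Function.comp_def] using (lipschitzWith_inner_right w).comp lipschitzWith_dev

theorem lipschitzWith_glue {e : E3} (he0 : 0 ≤ e 0) (he2 : e 2 = 0) {C D : ℝ≥0}
    {G : Fin n × Bool → E3 → ℝ} (hG : ∀ j, LipschitzWith C (G j))
    (hD : ∀ j p, |G j p| ≤ D * |inner ℝ e p|) (hC : D * ‖e‖₊ ≤ C) (hC0 : C ≠ 0) :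
    LipschitzWith C fun x : ConeProduct n K I => G (sheet e x) (dev x) := by
  intro x y
  rw [← edist_out x y]
  refine CutPoint.le_mul_edist hC0 fun l hl => ?_
  have := hl.edist_glue_le he0 he2 hG hD hC
  rwa [pos_out, pos_out] at this

theorem edist_le_of_sheet_eq (hK : Convex ℝ K) (hI : I.OrdConnected) {e : E3}
    (he0 : 0 ≤ e 0) (he2 : e 2 = 0) {x y : ConeProduct n K I} (hs : sheet e x = sheet e y)
    (hx : inner ℝ e (dev x) ≠ 0) (hy : inner ℝ e (dev y) ≠ 0) :
    edist x y ≤ edist (dev x) (dev y) := by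
  rw [← edist_out, ← pos_out, ← pos_out]
  rw [← pos_out] at hx hy
  exact CutPoint.edist_le_of_sheet_eq hK hI he0 he2 hs hx hy

/-- The function equal to `⟨e, dev⟩` on one half space and to `0` on the others is continuous by
gluing, and nonzero only on that half space. -/
theorem eventually_sheet_eq {e : E3} (he0 : 0 ≤ e 0) (he2 : e 2 = 0) {x : ConeProduct n K I}
    (hx : inner ℝ e (dev x) ≠ 0) : ∀ᶠ y in 𝓝 x, sheet e y = sheet e x := by
  classical
  set j := sheet e x
  have hG := fun i => lipschitzWith_ite_inner e (i = j)
  have hl := lipschitzWith_glue (K := K) (I := I) he0 he2 hG (D := 1) (fun i p => by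
    by_cases h : i = j <;> simp [h]) (by simp) (fun h => hx (by simp [nnnorm_eq_zero.1 h]))
  have hne := hl.continuous.continuousAt.eventually_ne (x := x) (y := 0) (by simpa [j] using hx)
  filter_upwards [hne] with y hy
  by_contra h
  simp [h] at hy

/-- `sheet` uses a chosen representative. Off the wall the choice is irrelevant: a glued function
singling out one half space takes equal values at points at distance zero. -/
theorem sheet_mk {e : E3} (he0 : 0 ≤ e 0) (he2 : e 2 = 0) {a : CutPoint n K I}
    (ha : inner ℝ e a.pos ≠ 0) : sheet e (SeparationQuotient.mk a) = a.sheet e := by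
  classical
  set b : CutPoint n K I := Quotient.out (SeparationQuotient.mk a)
  set j := a.sheet e with hj
  have hG := fun i => lipschitzWith_ite_inner e (i = j)
  have h0 : edist a b = 0 := by
    rw [← SeparationQuotient.edist_mk, mk_out, edist_self]
  have hle : edist (if a.sheet e = j then inner ℝ e a.pos else (0 : ℝ))
      (if b.sheet e = j then inner ℝ e b.pos else (0 : ℝ)) ≤ ‖e‖₊ * edist a b := by
    refine CutPoint.le_mul_edist ?_ fun l hl => ?_
    · rintro h
      exact ha (by simp [nnnorm_eq_zero.1 h])
    exact hl.edist_glue_le he0 he2 hG (D := 1) (fun i p => by by_cases h : i = j <;> simp [h])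
      (by simp)
  rw [h0, mul_zero, nonpos_iff_eq_zero, edist_eq_zero, if_pos hj.symm] at hle
  by_contra h
  have h' : b.sheet e ≠ j := h
  rw [if_neg h'] at hle
  exact ha hle

end

section

/-! ### Linear algebra of a plane in space -/

theorem tripleProduct_eq (u v w : E3) : tripleProduct u v w =
    u 0 * (v 1 * w 2 - v 2 * w 1) - u 1 * (v 0 * w 2 - v 2 * w 0) +
      u 2 * (v 0 * w 1 - v 1 * w 0) := by
  simp [tripleProduct, Matrix.det_fin_three]
  ring

theorem tripleProduct_smul (c : ℝ) (u v w : E3) :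
    tripleProduct (c • u) v w = c * tripleProduct u v w := by
  simp only [tripleProduct_eq, PiLp.smul_apply, smul_eq_mul]
  ring

theorem norm_sq_eq (u : E3) : ‖u‖ ^ 2 = u 0 ^ 2 + u 1 ^ 2 + u 2 ^ 2 := by
  simp [EuclideanSpace.norm_sq_eq, Fin.sum_univ_three]

/-- The cross product of two vectors orthogonal to `u` is a multiple of `u`; hence only the normal
component of `V` enters the flux through a leaf. -/
theorem tripleProduct_of_orthogonal {u : E3} (hu : ‖u‖ = 1) {a b : E3} (ha : inner ℝ u a = 0)
    (hb : inner ℝ u b = 0) (V : E3) :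
    tripleProduct V a b = inner ℝ V u * tripleProduct u a b := by
  have h := norm_sq_eq u
  rw [hu, one_pow] at h
  rw [inner_eq_sum] at ha hb
  rw [tripleProduct_eq, tripleProduct_eq, inner_eq_sum]
  linear_combination (V 0 * (a 1 * b 2 - a 2 * b 1) - V 1 * (a 0 * b 2 - a 2 * b 0) +
      V 2 * (a 0 * b 1 - a 1 * b 0)) * h
    - (V 0 * (u 2 * b 1 - u 1 * b 2) + V 1 * (u 0 * b 2 - u 2 * b 0) +
      V 2 * (u 1 * b 0 - u 0 * b 1)) * ha
    + (V 0 * (u 2 * a 1 - u 1 * a 2) + V 1 * (u 0 * a 2 - u 2 * a 0) +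
      V 2 * (u 1 * a 0 - u 0 * a 1)) * hb

/-- `(x, y)` is a horizontal direction orthogonal to `(a, b)`. The sign of `w` is free, which allows
`0 ≤ x`, as the labelling of the sheets requires. -/
theorem exists_horizontal_parameters {a b c : ℝ} (h : a ^ 2 + b ^ 2 + c ^ 2 = 1) :
    ∃ x y w : ℝ, 0 ≤ x ∧ x ^ 2 + y ^ 2 = 1 ∧ a = -w * y ∧ b = w * x ∧ w ^ 2 + c ^ 2 = 1 := by
  by_cases h0 : a ^ 2 + b ^ 2 = 0
  · have ha : a = 0 := by nlinarith [sq_nonneg a, sq_nonneg b]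
    have hb : b = 0 := by nlinarith [sq_nonneg a, sq_nonneg b]
    exact ⟨1, 0, 0, zero_le_one, by norm_num, by simp [ha], by simp [hb], by linarith⟩
  · set r := √(a ^ 2 + b ^ 2)
    have hr2 : r ^ 2 = a ^ 2 + b ^ 2 := Real.sq_sqrt (by positivity)
    have hr : 0 < r := Real.sqrt_pos.2 (lt_of_le_of_ne (by positivity) (Ne.symm h0))
    rcases le_total 0 b with hb | hb
    · refine ⟨b / r, -a / r, r, by positivity, ?_, ?_, ?_, by linarith⟩
      · rw [div_pow, div_pow, ← add_div, hr2, div_eq_one_iff_eq h0]; ring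
      · field_simp
      · field_simp
    · refine ⟨-b / r, a / r, -r, div_nonneg (by linarith) hr.le, ?_, ?_, ?_, by nlinarith⟩
      · rw [div_pow, div_pow, ← add_div, hr2, div_eq_one_iff_eq h0]; ring
      · field_simp
      · field_simp

/-- An orthonormal basis `e, σ` of the plane orthogonal to `u` with `e` horizontal. -/
theorem exists_frame {u : E3} (hu : ‖u‖ = 1) : ∃ e σ : E3, 0 ≤ e 0 ∧ e 2 = 0 ∧ ‖e‖ = 1 ∧ ‖σ‖ = 1 ∧
    (∀ a b, tripleProduct u a b = inner ℝ e a * inner ℝ σ b - inner ℝ e b * inner ℝ σ a) ∧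
    ∀ p, inner ℝ u p = 0 → ‖p‖ ≤ |inner ℝ σ p| + |inner ℝ e p| := by
  have h := norm_sq_eq u
  rw [hu, one_pow] at h
  obtain ⟨x, y, w, hx, hxy, ha, hb, hw⟩ := exists_horizontal_parameters h.symm
  have hone : ∀ v : E3, v 0 ^ 2 + v 1 ^ 2 + v 2 ^ 2 = 1 → ‖v‖ = 1 := fun v hv => by
    have := norm_sq_eq v
    rw [hv] at this
    exact (pow_eq_one_iff_of_nonneg (norm_nonneg v) two_ne_zero).1 this
  have he1 : ‖(!₂[x, y, 0] : E3)‖ = 1 := hone _ (by simpa using hxy)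
  have hs1 : ‖(!₂[-(u 2 * y), u 2 * x, -w] : E3)‖ = 1 := hone _ (by
    simp
    linear_combination (u 2) ^ 2 * hxy + hw)
  -- The second vector is chosen so that `e × σ = u`.
  refine ⟨!₂[x, y, 0], !₂[-(u 2 * y), u 2 * x, -w], by simpa using hx, by simp, he1, hs1, ?_, ?_⟩
  · intro a b
    simp [tripleProduct_eq, inner_eq_sum, ha, hb]
    linear_combination (-u 2 * (a 0 * b 1 - a 1 * b 0)) * hxy
  · intro p hp
    rw [inner_eq_sum, ha, hb] at hp
    have hdec : p = inner ℝ (!₂[-(u 2 * y), u 2 * x, -w] : E3) p • !₂[-(u 2 * y), u 2 * x, -w] +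
        inner ℝ (!₂[x, y, 0] : E3) p • !₂[x, y, 0] := by
      ext i
      fin_cases i
      · simp [inner_eq_sum]
        linear_combination (-p 0) * hxy + (-p 0 * y ^ 2 + p 1 * x * y) * hw - w * y * hp
      · simp [inner_eq_sum]
        linear_combination (-p 1) * hxy + (p 0 * x * y - p 1 * x ^ 2) * hw + w * x * hp
      · simp [inner_eq_sum]
        linear_combination (-p 2) * hw + u 2 * hp
    calc ‖p‖ = ‖inner ℝ (!₂[-(u 2 * y), u 2 * x, -w] : E3) p • (!₂[-(u 2 * y), u 2 * x, -w] : E3) +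
        inner ℝ (!₂[x, y, 0] : E3) p • (!₂[x, y, 0] : E3)‖ := by rw [← hdec]
      _ ≤ _ := by
        refine (norm_add_le _ _).trans ?_
        rw [norm_smul, norm_smul, he1, hs1, mul_one, mul_one, Real.norm_eq_abs, Real.norm_eq_abs]

/-! ### Differentiating Lipschitz functions on the square -/

theorem ae_differentiableAt_of_lipschitzOn_square {E : Type*} [NormedAddCommGroup E]
    [NormedSpace ℝ E] [FiniteDimensional ℝ E] {F : ℝ × ℝ → E} {C : ℝ≥0}
    (hF : LipschitzOnWith C F square) : ∀ᵐ q, q ∈ square → DifferentiableAt ℝ F q := by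
  filter_upwards [hF.ae_differentiableWithinAt_of_mem (μ := volume), ae_square_mem_nhds] with q h1 h2 hq
  exact (h1 hq).differentiableAt (h2 hq)

/-- The differential of a Lipschitz function vanishes almost everywhere on its zero set. -/
theorem ae_fderiv_eq_zero {Y : ℝ × ℝ → ℝ} {C : ℝ≥0} (hY : LipschitzOnWith C Y square) :
    ∀ᵐ q, q ∈ square → Y q = 0 → fderiv ℝ Y q = 0 := by
  have habs : LipschitzOnWith (1 * C) (fun q => |Y q|) square :=
    (lipschitzWith_one_norm (E := ℝ)).comp_lipschitzOnWith hY
  filter_upwards [ae_differentiableAt_of_lipschitzOn_square habs] with q hq hqs h0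
  -- A zero of `Y` is a minimum of `|Y|`, so the derivative of `|Y|`, which exists almost
  -- everywhere, is zero there; this forces that of `Y` to be zero.
  have hmin : IsLocalMin (fun q => |Y q|) q := by
    filter_upwards with p
    simp [h0]
  have hd : HasFDerivAt (fun q => |Y q|) (0 : ℝ × ℝ →L[ℝ] ℝ) q := by
    rw [← hmin.fderiv_eq_zero]
    exact (hq hqs).hasFDerivAt
  refine HasFDerivAt.fderiv ?_
  rw [hasFDerivAt_iff_isLittleO] at hd ⊢
  simpa [h0] using hd

/-- If `R` varies at most as fast as `T`, then `dR ∧ dT = 0`. -/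
theorem wedge_eq_zero {E : Type*} [NormedAddCommGroup E] [NormedSpace ℝ E] {R T : E → ℝ}
    {A B : E →L[ℝ] ℝ} {q : E} (hR : HasFDerivAt R A q) (hT : HasFDerivAt T B q) {C : ℝ}
    (h : ∀ᶠ p in 𝓝 q, |R p - R q| ≤ C * |T p - T q|) (u v : E) : A u * B v - A v * B u = 0 := by
  -- A vector in the kernel of `B`: along it `T`, and therefore `R`, is constant to first order.
  set w := B v • u - B u • v
  have hBw : B w = 0 := by simp [w]; ring
  have h1 := hR.hasLineDerivAt w
  have h2 := hT.hasLineDerivAt w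
  rw [hBw] at h2
  have hO : (fun t : ℝ => R (q + t • w) - R q) =O[𝓝 0] fun t : ℝ => T (q + t • w) - T q := by
    have hc : Tendsto (fun t : ℝ => q + t • w) (𝓝 0) (𝓝 q) := by
      have : Continuous fun t : ℝ => q + t • w := by fun_prop
      simpa using this.tendsto 0
    refine Asymptotics.IsBigO.of_bound C ?_
    filter_upwards [hc.eventually h] with t ht
    exact ht
  have h3 : HasLineDerivAt ℝ R 0 q w := by
    rw [HasLineDerivAt, hasDerivAt_iff_isLittleO_nhds_zero] at h2 ⊢
    simp only [zero_add, zero_smul, add_zero, smul_zero, sub_zero] at h2 ⊢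
    exact hO.trans_isLittleO h2
  have hAw : A w = 0 := HasDerivAt.unique h1 h3
  simp only [w, map_sub, map_smul, smul_eq_mul] at hAw
  linarith

/-! ### Regularization -/

/-- Infimal convolution with `m * dist`, capped at `1`. Its value at `z i` never exceeds `h i`, so
convergence needs only lower semicontinuity of `h` as seen through `z`. -/
theorem exists_lipschitz_approx {ι : Type*} (h : ι → ℝ) (hh : ∀ i, |h i| ≤ 1) (z : ι → ℝ × ℝ) :
    ∃ k : ℕ → ℝ × ℝ → ℝ, (∀ m : ℕ, LipschitzWith m (k m)) ∧ (∀ m p, |k m p| ≤ 1) ∧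
      ∀ i, (∀ ε > 0, ∃ δ > 0, ∀ i', dist (z i) (z i') < δ → h i - ε < h i') →
        Tendsto (fun m => k m (z i)) atTop (𝓝 (h i)) := by
  rcases isEmpty_or_nonempty ι with hι | hι
  · exact ⟨fun _ _ => 0, fun m => (LipschitzWith.const 0).weaken zero_le, by simp,
      fun i => isEmptyElim i⟩
  have hb : ∀ (m : ℕ) (p : ℝ × ℝ) (i : ι), -1 ≤ h i + m * dist p (z i) := fun m p i => by
    have := (abs_le.1 (hh i)).1
    have : 0 ≤ (m : ℝ) * dist p (z i) := by positivity
    linarith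
  have hbb : ∀ (m : ℕ) (p : ℝ × ℝ), BddBelow (Set.range fun i => h i + m * dist p (z i)) :=
    fun m p => ⟨-1, by rintro _ ⟨i, rfl⟩; exact hb m p i⟩
  refine ⟨fun m p => min 1 (⨅ i, h i + m * dist p (z i)), fun m => ?_, fun m p => ?_, ?_⟩
  · refine LipschitzWith.const_min (LipschitzWith.of_le_add_mul _ fun p q => ?_) 1
    rw [← sub_le_iff_le_add]
    refine le_ciInf fun i => ?_
    rw [sub_le_iff_le_add]
    refine (ciInf_le (hbb m p) i).trans ?_
    have := mul_le_mul_of_nonneg_left (dist_triangle_left p (z i) q) (Nat.cast_nonneg (α := ℝ) m)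
    rw [dist_comm q p] at this
    push_cast
    linarith
  · rw [abs_le]
    exact ⟨le_min (by norm_num) (le_ciInf (hb m p)), min_le_left _ _⟩
  · intro i hi
    rw [Metric.tendsto_atTop]
    intro ε hε
    obtain ⟨δ, hδ, hd⟩ := hi (ε / 2) (half_pos hε)
    -- Beyond distance `δ` the penalty is then at least `2`, the largest possible oscillation of
    -- `h`.
    obtain ⟨N, hN⟩ := exists_nat_ge (2 / δ)
    refine ⟨N, fun m hm => ?_⟩
    have hup : min 1 (⨅ i', h i' + m * dist (z i) (z i')) ≤ h i := by
      refine (min_le_right _ _).trans ((ciInf_le (hbb m (z i)) i).trans ?_)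
      simp
    have hlo : h i - ε / 2 ≤ min 1 (⨅ i', h i' + m * dist (z i) (z i')) := by
      have h1 := (abs_le.1 (hh i)).2
      refine le_min (by linarith) (le_ciInf fun i' => ?_)
      by_cases hc : dist (z i) (z i') < δ
      · have := hd i' hc
        have : 0 ≤ (m : ℝ) * dist (z i) (z i') := by positivity
        linarith
      · have h2 : (2 / δ) * δ ≤ m * dist (z i) (z i') := by
          gcongr
          · exact hN.trans (by exact_mod_cast hm)
          · exact not_lt.1 hc
        rw [div_mul_cancel₀ _ hδ.ne'] at h2
        have := (abs_le.1 (hh i')).1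
        linarith
    rw [Real.dist_eq, abs_lt]
    constructor <;> linarith

/-- A cutoff vanishing at `0` and near infinity. -/
noncomputable def cutoff (m : ℕ) (t : ℝ) : ℝ := max 0 (min 1 (min (m * |t|) (m + 1 - |t|)))

theorem cutoff_nonneg (m : ℕ) (t : ℝ) : 0 ≤ cutoff m t := le_max_left _ _

theorem cutoff_le_one (m : ℕ) (t : ℝ) : cutoff m t ≤ 1 := max_le zero_le_one (min_le_left _ _)

theorem cutoff_le (m : ℕ) (t : ℝ) : cutoff m t ≤ m * |t| :=
  max_le (by positivity) ((min_le_right _ _).trans (min_le_left _ _))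

theorem lipschitzWith_cutoff (m : ℕ) : LipschitzWith (m + 1) (cutoff m) := by
  have habs : ∀ x y : ℝ, |(|x| - |y|)| ≤ |x - y| := abs_abs_sub_abs_le_abs_sub
  have h1 : LipschitzWith m fun t : ℝ => m * |t| := LipschitzWith.of_dist_le_mul fun x y => by
    rw [Real.dist_eq, Real.dist_eq, ← mul_sub, abs_mul, Nat.abs_cast]
    push_cast
    exact mul_le_mul_of_nonneg_left (habs x y) (Nat.cast_nonneg m)
  have h2 : LipschitzWith 1 fun t : ℝ => m + 1 - |t| := LipschitzWith.of_dist_le_mul fun x y => by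
    rw [Real.dist_eq, Real.dist_eq, abs_sub_comm x y]
    have : (m : ℝ) + 1 - |x| - (m + 1 - |y|) = |y| - |x| := by ring
    rw [this]
    simpa using habs y x
  exact (((h1.min h2).const_min 1).const_max 0).weaken (max_le (by simp) (by simp))

theorem hasCompactSupport_cutoff (m : ℕ) : HasCompactSupport (cutoff m) := by
  refine HasCompactSupport.of_support_subset_isCompact
    (isCompact_Icc (a := -((m : ℝ) + 1)) (b := m + 1)) fun t ht => ?_
  refine abs_le.1 ?_
  by_contra h
  apply ht
  exact max_eq_left ((min_le_right _ _).trans ((min_le_right _ _).trans (by linarith)))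

theorem tendsto_cutoff {t : ℝ} (ht : t ≠ 0) : Tendsto (fun m => cutoff m t) atTop (𝓝 1) := by
  refine tendsto_const_nhds.congr' ?_
  obtain ⟨N, hN⟩ := exists_nat_ge (max (1 / |t|) |t|)
  filter_upwards [eventually_ge_atTop N] with m hm
  have hm' : max (1 / |t|) |t| ≤ m := hN.trans (by exact_mod_cast hm)
  have h1 : 1 ≤ m * |t| := by
    rw [← div_le_iff₀ (abs_pos.2 ht)]
    exact (le_max_left _ _).trans hm'
  have h2 : 1 ≤ m + 1 - |t| := by linarith [(le_max_right (1 / |t|) |t|).trans hm']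
  rw [cutoff, min_eq_left (le_min h1 h2), max_eq_right zero_le_one]

/-- The primitive in the second variable, vanishing at `0`. -/
noncomputable def primitive (k : ℝ × ℝ → ℝ) (ρ : ℝ → ℝ) (s t : ℝ) : ℝ :=
  ∫ τ in (0 : ℝ)..t, k (s, τ) * ρ τ

section Primitive

variable {k : ℝ × ℝ → ℝ} {ρ : ℝ → ℝ} {L : ℝ≥0}

theorem hasDerivAt_primitive (hk : Continuous k) (hρ : Continuous ρ) (s t : ℝ) :
    HasDerivAt (primitive k ρ s) (k (s, t) * ρ t) t := by
  have hc : Continuous fun τ => k (s, τ) * ρ τ := by fun_prop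
  exact intervalIntegral.integral_hasDerivAt_right (hc.intervalIntegrable _ _)
    (hc.stronglyMeasurableAtFilter _ _) hc.continuousAt

theorem abs_primitive_sub_le_right (hk : Continuous k) (hρ : Continuous ρ)
    (hk1 : ∀ p, |k p| ≤ 1) (hρ1 : ∀ t, |ρ t| ≤ 1) (s t t' : ℝ) :
    |primitive k ρ s t - primitive k ρ s t'| ≤ |t - t'| := by
  have hc : Continuous fun τ => k (s, τ) * ρ τ := by fun_prop
  rw [primitive, primitive, intervalIntegral.integral_interval_sub_left
    (hc.intervalIntegrable _ _) (hc.intervalIntegrable _ _)]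
  have := intervalIntegral.norm_integral_le_of_norm_le_const (a := t') (b := t) (C := 1)
    (f := fun τ => k (s, τ) * ρ τ) fun x _ => by
      rw [Real.norm_eq_abs, abs_mul]
      exact mul_le_one₀ (hk1 _) (abs_nonneg _) (hρ1 _)
  simpa using this

/-- Integrability of `ρ` makes the bound uniform in `t`. This is why the cutoff also vanishes near
infinity: `K` and `I` may be unbounded. -/
theorem abs_primitive_sub_le_left (hk : LipschitzWith L k) (hρ : Continuous ρ)
    (hρc : HasCompactSupport ρ) (s s' t : ℝ) :
    |primitive k ρ s t - primitive k ρ s' t| ≤ L * (∫ τ, |ρ τ|) * |s - s'| := by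
  have hkc := hk.continuous
  have hc : ∀ s, Continuous fun τ => k (s, τ) * ρ τ := fun s => by fun_prop
  have hρi : Integrable fun τ => |ρ τ| := (hρ.integrable_of_hasCompactSupport hρc).abs
  rw [primitive, primitive, ← intervalIntegral.integral_sub ((hc _).intervalIntegrable _ _)
    ((hc _).intervalIntegrable _ _)]
  calc |∫ τ in (0 : ℝ)..t, (k (s, τ) * ρ τ - k (s', τ) * ρ τ)|
      ≤ ∫ τ in Set.uIoc 0 t, |k (s, τ) * ρ τ - k (s', τ) * ρ τ| :=
        intervalIntegral.norm_integral_le_integral_norm_uIoc (E := ℝ)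
    _ ≤ ∫ τ in Set.uIoc 0 t, L * |s - s'| * |ρ τ| := by
        refine integral_mono_of_nonneg (.of_forall fun _ => abs_nonneg _)
          ((hρi.const_mul _).integrableOn) (.of_forall fun τ => ?_)
        simp only
        rw [← sub_mul, abs_mul]
        gcongr
        have := hk.dist_le_mul (s, τ) (s', τ)
        simpa [Prod.dist_eq, Real.dist_eq] using this
    _ ≤ ∫ τ, L * |s - s'| * |ρ τ| :=
        setIntegral_le_integral (hρi.const_mul _) (.of_forall fun _ => by positivity)
    _ = _ := by rw [integral_const_mul]; ring

end Primitive

end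

section

variable {n : ℕ} [NeZero n] {K : Set (EuclideanSpace ℝ (Fin 2))} {I : Set ℝ}

/-! ### Calibrations -/

/-- The coefficient of a calibration: in each half space a function of the coordinates
`⟨σ, ·⟩, ⟨e, ·⟩`, cut off near the walls. -/
noncomputable def calibration (e σ : E3) (k : Fin n × Bool → ℝ × ℝ → ℝ) (ρ : ℝ → ℝ)
    (x : ConeProduct n K I) : ℝ :=
  k (sheet e x) (inner ℝ σ (dev x), inner ℝ e (dev x)) * ρ (inner ℝ e (dev x))

/-- A function `f` such that `df ∧ d⟨σ, ·⟩` is the calibration form. -/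
noncomputable def potential (e σ : E3) (k : Fin n × Bool → ℝ × ℝ → ℝ) (ρ : ℝ → ℝ)
    (x : ConeProduct n K I) : ℝ :=
  primitive (k (sheet e x)) ρ (inner ℝ σ (dev x)) (inner ℝ e (dev x))

theorem lipschitzWith_inner {w : E3} (hw : ‖w‖ = 1) : LipschitzWith 1 fun p : E3 => inner ℝ w p :=
  (lipschitzWith_inner_right w).weaken (by rw [← NNReal.coe_le_coe]; simp [hw])

section

variable {e σ : E3} {k : Fin n × Bool → ℝ × ℝ → ℝ} {ρ : ℝ → ℝ} {L R M : ℝ≥0}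

/-- The functions `k j` are unrelated for different half spaces; the bound `M * |t|` on `ρ` makes
the products match at the wall. Continuity is needed for the calibration to be admissible in the
definition of area. -/
theorem lipschitzWith_calibration (he0 : 0 ≤ e 0) (he2 : e 2 = 0) (he : ‖e‖ = 1) (hσ : ‖σ‖ = 1)
    (hk : ∀ j, LipschitzWith L (k j)) (hk1 : ∀ j p, |k j p| ≤ 1) (hρ : LipschitzWith R ρ)
    (hρ1 : ∀ t, |ρ t| ≤ 1) (hρ0 : ∀ t, |ρ t| ≤ M * |t|) :
    ∃ C, LipschitzWith C (calibration (K := K) (I := I) e σ k ρ) := by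
  have hz : LipschitzWith 1 fun p : E3 => ((inner ℝ σ p, inner ℝ e p) : ℝ × ℝ) := by
    simpa using (lipschitzWith_inner hσ).prodMk (lipschitzWith_inner he)
  refine ⟨(1 * (R * 1) + 1 * (L * 1)) + M + 1, lipschitzWith_glue
    (G := fun j p => k j (inner ℝ σ p, inner ℝ e p) * ρ (inner ℝ e p)) (D := M) he0 he2
    (fun j => ?_) (fun j p => ?_) ?_ (by positivity)⟩
  · refine (lipschitzWith_mul_of_bounded (A := 1) (B := 1) ((hk j).comp hz)
      (hρ.comp (lipschitzWith_inner he)) (fun p => hk1 j _) (fun p => hρ1 _)).weaken ?_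
    rw [add_assoc]
    exact le_self_add
  · rw [abs_mul]
    refine (mul_le_of_le_one_left (abs_nonneg _) (hk1 j _)).trans (hρ0 _)
  · have : ‖e‖₊ = 1 := by ext; simpa using he
    rw [this, mul_one, add_assoc, add_left_comm]
    exact le_self_add

theorem abs_calibration_le (hk1 : ∀ j p, |k j p| ≤ 1) (hρ1 : ∀ t, |ρ t| ≤ 1)
    (x : ConeProduct n K I) : |calibration e σ k ρ x| ≤ 1 := by
  rw [calibration, abs_mul]
  exact mul_le_one₀ (hk1 _ _) (abs_nonneg _) (hρ1 _)

/-- The primitive starts at the wall and its integrand is at most `1` in absolute value, so it is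
bounded by `|⟨e, ·⟩|` and the pieces glue. -/
theorem lipschitzWith_potential (he0 : 0 ≤ e 0) (he2 : e 2 = 0) (he : ‖e‖ = 1) (hσ : ‖σ‖ = 1)
    (hk : ∀ j, LipschitzWith L (k j)) (hk1 : ∀ j p, |k j p| ≤ 1) (hρ : Continuous ρ)
    (hρ1 : ∀ t, |ρ t| ≤ 1) (hρc : HasCompactSupport ρ) :
    ∃ C, LipschitzWith C (potential (K := K) (I := I) e σ k ρ) := by
  have hB : 0 ≤ ∫ τ, |ρ τ| := integral_nonneg fun _ => abs_nonneg _
  obtain ⟨B, hBdef⟩ : ∃ B : ℝ≥0, (B : ℝ) = ∫ τ, |ρ τ| := ⟨_, Real.coe_toNNReal _ hB⟩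
  refine ⟨L * B + 1, lipschitzWith_glue
    (G := fun j p => primitive (k j) ρ (inner ℝ σ p) (inner ℝ e p)) (D := 1) he0 he2
    (fun j => LipschitzWith.of_dist_le_mul fun p q => ?_) (fun j p => ?_) ?_ (by positivity)⟩
  · have h1 := abs_primitive_sub_le_left (hk j) hρ hρc (inner ℝ σ p) (inner ℝ σ q) (inner ℝ e p)
    have h2 := abs_primitive_sub_le_right (hk j).continuous hρ (hk1 j) hρ1 (inner ℝ σ q)
      (inner ℝ e p) (inner ℝ e q)
    have h3 := (lipschitzWith_inner hσ).dist_le_mul p q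
    have h4 := (lipschitzWith_inner he).dist_le_mul p q
    rw [NNReal.coe_one, one_mul, Real.dist_eq] at h3 h4
    rw [Real.dist_eq]
    calc _ ≤ |primitive (k j) ρ (inner ℝ σ p) (inner ℝ e p) -
          primitive (k j) ρ (inner ℝ σ q) (inner ℝ e p)| +
          |primitive (k j) ρ (inner ℝ σ q) (inner ℝ e p) -
          primitive (k j) ρ (inner ℝ σ q) (inner ℝ e q)| := abs_sub_le _ _ _
      _ ≤ L * (∫ τ, |ρ τ|) * dist p q + dist p q := by
          refine add_le_add (h1.trans ?_) (h2.trans h4)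
          gcongr
      _ = _ := by
          rw [NNReal.coe_add, NNReal.coe_mul, hBdef, NNReal.coe_one]
          ring
  · have h2 := abs_primitive_sub_le_right (hk j).continuous hρ (hk1 j) hρ1 (inner ℝ σ p)
      (inner ℝ e p) 0
    simpa [primitive] using h2
  · have : ‖e‖₊ = 1 := by ext; simpa using he
    rw [this]
    simp

/-- `df ∧ d⟨σ, ·⟩` is the calibration form. -/
theorem ae_wedge_potential (he0 : 0 ≤ e 0) (he2 : e 2 = 0) (he : ‖e‖ = 1) (hσ : ‖σ‖ = 1)
    (hk : ∀ j, LipschitzWith L (k j)) (hk1 : ∀ j p, |k j p| ≤ 1) (hρ : Continuous ρ)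
    (hρ1 : ∀ t, |ρ t| ≤ 1) (hρc : HasCompactSupport ρ) {φ : ℝ × ℝ → ConeProduct n K I} {C : ℝ≥0}
    (hφ : LipschitzOnWith C φ square) : ∀ᵐ q, q ∈ square → ∀ v w,
      fderiv ℝ (potential e σ k ρ ∘ φ) q v * fderiv ℝ ((fun x => inner ℝ σ (dev x)) ∘ φ) q w -
        fderiv ℝ (potential e σ k ρ ∘ φ) q w * fderiv ℝ ((fun x => inner ℝ σ (dev x)) ∘ φ) q v =
      calibration e σ k ρ (φ q) *
        (inner ℝ e (fderiv ℝ (dev ∘ φ) q v) * inner ℝ σ (fderiv ℝ (dev ∘ φ) q w) -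
          inner ℝ e (fderiv ℝ (dev ∘ φ) q w) * inner ℝ σ (fderiv ℝ (dev ∘ φ) q v)) := by
  obtain ⟨CP, hP⟩ := lipschitzWith_potential (K := K) (I := I) he0 he2 he hσ hk hk1 hρ hρ1 hρc
  have hB : 0 ≤ ∫ τ, |ρ τ| := integral_nonneg fun _ => abs_nonneg _
  filter_upwards [ae_square_mem_nhds,
    ae_differentiableAt_of_lipschitzOn_square (hP.comp_lipschitzOnWith hφ),
    ae_differentiableAt_of_lipschitzOn_square (lipschitzWith_dev.comp_lipschitzOnWith hφ),
    ae_fderiv_eq_zero ((lipschitzWith_inner_dev e).comp_lipschitzOnWith hφ)] with q hn hF hd h0 hq v w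
  have hdq := (hd hq).hasFDerivAt
  have hFq := (hF hq).hasFDerivAt
  have hcomp : ∀ a : E3, HasFDerivAt ((fun x => inner ℝ a (dev x)) ∘ φ)
      ((innerSL ℝ a).comp (fderiv ℝ (dev ∘ φ) q)) q := fun a =>
    (innerSL ℝ a).hasFDerivAt.comp q hdq
  have hT := hcomp σ
  have hY := hcomp e
  set A := fderiv ℝ (potential e σ k ρ ∘ φ) q
  set Dv := fderiv ℝ (dev ∘ φ) q
  rw [hT.fderiv]
  have hcont : ContinuousAt φ q := hφ.continuousOn.continuousAt (hn hq)
  -- On the wall the sheet need not be locally constant. But almost everywhere there the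
  -- differential of `⟨e, dev ∘ φ⟩` is zero, and so is that of the potential, which it dominates:
  -- both sides vanish.
  by_cases hYq : inner ℝ e (dev (φ q)) = 0
  · have hY0 : (innerSL ℝ e).comp Dv = 0 := by
      rw [← hY.fderiv]
      exact h0 hq hYq
    have hev : ∀ v, inner ℝ e (Dv v) = 0 := fun v => by
      have := congrArg (fun l => l v) hY0
      simpa using this
    have hA : HasFDerivAt (potential e σ k ρ ∘ φ) (0 : ℝ × ℝ →L[ℝ] ℝ) q := by
      rw [hY0] at hY
      rw [hasFDerivAt_iff_isLittleO] at hY ⊢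
      have hp0 : ∀ x : ConeProduct n K I,
          |potential e σ k ρ x| ≤ |inner ℝ e (dev x)| := fun x => by
        have h2 := abs_primitive_sub_le_right (hk (sheet e x)).continuous hρ (hk1 _) hρ1
          (inner ℝ σ (dev x)) (inner ℝ e (dev x)) 0
        simpa [primitive, potential] using h2
      have hpq : potential e σ k ρ (φ q) = 0 := by
        have := hp0 (φ q)
        rw [hYq, abs_zero] at this
        exact abs_nonpos_iff.1 this
      refine Asymptotics.IsBigO.trans_isLittleO (Asymptotics.IsBigO.of_bound 1 ?_) hY
      filter_upwards with p
      simpa [hpq, hYq] using hp0 (φ p)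
    have hA0 : A = 0 := hA.fderiv
    simp [hA0, hev]
  · set j := sheet e (φ q) with hj
    set s₀ := inner ℝ σ (dev (φ q)) with hs₀
    have hsheet : ∀ᶠ p in 𝓝 q, sheet e (φ p) = j :=
      hcont.eventually (eventually_sheet_eq he0 he2 hYq)
    have hH : HasFDerivAt (fun p => primitive (k j) ρ s₀ (inner ℝ e (dev (φ p))))
        ((k j (s₀, inner ℝ e (dev (φ q))) * ρ (inner ℝ e (dev (φ q)))) •
          (innerSL ℝ e).comp Dv) q :=
      (hasDerivAt_primitive (hk j).continuous hρ s₀ _).comp_hasFDerivAt q hY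
    -- As `k` is only Lipschitz, the potential is compared with the function in which the
    -- `σ`-coordinate is frozen at `s₀`. The difference varies at most at a constant times the rate
    -- of `⟨σ, ·⟩`, so its wedge with `d⟨σ, ·⟩` is zero.
    have hw := wedge_eq_zero (hFq.sub hH) hT (C := L * ∫ τ, |ρ τ|) (by
      filter_upwards [hsheet] with p hp
      have h1 := abs_primitive_sub_le_left (hk j) hρ hρc (inner ℝ σ (dev (φ p))) s₀
        (inner ℝ e (dev (φ p)))
      simpa [potential, hp, ← hj, ← hs₀] using h1) v w
    simp only [sub_apply, smul_apply,
      ContinuousLinearMap.comp_apply, innerSL_apply_apply, smul_eq_mul] at hw ⊢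
    have hcal : calibration e σ k ρ (φ q) =
      k j (s₀, inner ℝ e (dev (φ q))) * ρ (inner ℝ e (dev (φ q))) := rfl
    rw [hcal]
    linear_combination hw

/-- By `hframe` the flux integrand is `df ∧ d⟨σ, dev⟩` with `f` the potential, and `HasBoundary`
applies to this pair. The resulting integral does not involve `S`. -/
theorem flux_calibration_eq {u : E3} (he0 : 0 ≤ e 0) (he2 : e 2 = 0) (he : ‖e‖ = 1) (hσ : ‖σ‖ = 1)
    (hframe : ∀ a b, tripleProduct u a b = inner ℝ e a * inner ℝ σ b - inner ℝ e b * inner ℝ σ a)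
    (hk : ∀ j, LipschitzWith L (k j)) (hk1 : ∀ j p, |k j p| ≤ 1) (hρ : Continuous ρ)
    (hρ1 : ∀ t, |ρ t| ≤ 1) (hρc : HasCompactSupport ρ) {S : Surface n K I}
    {γ : ℝ → ConeProduct n K I} (hS : S.HasBoundary γ) :
    S.flux (fun x => calibration e σ k ρ x • u) = ∫ t in (0 : ℝ)..1,
      potential e σ k ρ (γ t) * deriv ((fun x => inner ℝ σ (dev x)) ∘ γ) t := by
  rw [← hS _ _ (lipschitzWith_potential he0 he2 he hσ hk hk1 hρ hρ1 hρc)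
    ⟨_, lipschitzWith_inner_dev σ⟩, Surface.flux]
  refine Finset.sum_congr rfl fun i _ => ?_
  congr 1
  obtain ⟨C, hC⟩ := S.lipschitz i
  refine setIntegral_congr_ae measurableSet_square ?_
  filter_upwards [ae_wedge_potential he0 he2 he hσ hk hk1 hρ hρ1 hρc hC] with q hq hqs
  rw [hq hqs, tripleProduct_smul, hframe]

end

/-! ### The area comparison. -/

/-- A surface contained in a level set has least area among the surfaces with the same boundary. -/
theorem area_le_area (hK : Convex ℝ K) (hI : I.OrdConnected) {ν : E3} (hν : ν ≠ 0) {c : ℝ}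
    {S S' : Surface n K I} (hS : S.carrier ⊆ level ν c) {γ : ℝ → ConeProduct n K I}
    (hb : S.HasBoundary γ) (hb' : S'.HasBoundary γ) : S.area ≤ S'.area := by
  refine iSup_le fun V => iSup_le fun hV => iSup_le fun hV1 => ?_
  set u : E3 := ‖ν‖⁻¹ • ν with hudef
  have hν0 : ‖ν‖ ≠ 0 := norm_ne_zero_iff.2 hν
  have hu : ‖u‖ = 1 := by rw [hudef, norm_smul, norm_inv, norm_norm, inv_mul_cancel₀ hν0]
  obtain ⟨e, σ, he0, he2, he, hσ, hframe, hnorm⟩ := exists_frame hu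
  have hlev : ∀ x : ConeProduct n K I, x ∈ level ν c → inner ℝ u (dev x) = ‖ν‖⁻¹ * c := by
    intro x hx
    rw [hudef, inner_smul_left, show inner ℝ ν (dev x) = c from hx]
    simp
  set h : ConeProduct n K I → ℝ := fun x => inner ℝ (V x) u with hh
  have hhc : Continuous h := hV.inner continuous_const
  have hh1 : ∀ x, |h x| ≤ 1 := fun x => by
    refine (abs_real_inner_le_norm _ _).trans ?_
    rw [hu, mul_one]
    exact hV1 x
  -- For each half space, the values of `h` on the level set off the wall are placed at the plane
  -- coordinates of the points.
  have happ := fun j : Fin n × Bool => exists_lipschitz_approx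
    (ι := {y : ConeProduct n K I // y ∈ level ν c ∧ sheet e y = j ∧ inner ℝ e (dev y) ≠ 0})
    (fun y => h y) (fun y => hh1 y) (fun y => (inner ℝ σ (dev y.1), inner ℝ e (dev y.1)))
  choose k hkL hk1 hkt using happ
  have hlim : ∀ x : ConeProduct n K I, x ∈ level ν c → inner ℝ e (dev x) ≠ 0 →
      Tendsto (fun m => calibration e σ (fun j => k j m) (cutoff m) x) atTop (𝓝 (h x)) := by
    intro x hx hxe
    have h1 := hkt (sheet e x) ⟨x, hx, rfl, hxe⟩ (by
      intro ε hε
      have hnhds : {y | h x - ε < h y} ∈ 𝓝 x :=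
        hhc.continuousAt.eventually (lt_mem_nhds (by linarith))
      obtain ⟨δ, hδ, hball⟩ := EMetric.mem_nhds_iff.1 hnhds
      -- Half the radius, because on the level the distance is bounded by the sum of two coordinate
      -- differences; the radius itself may be `⊤`.
      obtain ⟨δ', hδ', hδδ⟩ : ∃ δ' : ℝ, 0 < δ' ∧ ENNReal.ofReal (δ' + δ') ≤ δ := by
        rcases eq_or_ne δ ⊤ with rfl | hne
        · exact ⟨1, one_pos, le_top⟩
        · have := ENNReal.toReal_pos hδ.ne' hne
          exact ⟨δ.toReal / 2, by positivity, by rw [add_halves, ENNReal.ofReal_toReal hne]⟩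
      refine ⟨δ', hδ', ?_⟩
      rintro ⟨y, hy, hys, hye⟩ hdist
      simp only at hdist ⊢
      refine hball ?_
      rw [Metric.mem_eball, edist_comm]
      refine lt_of_le_of_lt (edist_le_of_sheet_eq hK hI he0 he2 hys.symm hxe hye) ?_
      refine lt_of_lt_of_le ?_ hδδ
      rw [edist_dist, ENNReal.ofReal_lt_ofReal_iff (by positivity), dist_eq_norm]
      refine lt_of_le_of_lt (hnorm _ (by rw [inner_sub_right, hlev x hx, hlev y hy, sub_self])) ?_
      rw [Prod.dist_eq, max_lt_iff, Real.dist_eq, Real.dist_eq] at hdist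
      rw [inner_sub_right, inner_sub_right]
      exact add_lt_add hdist.1 hdist.2)
    have h2 := h1.mul (tendsto_cutoff hxe)
    rwa [mul_one] at h2
  have hρ1 : ∀ (m : ℕ) t, |cutoff m t| ≤ 1 := fun m t => by
    rw [abs_of_nonneg (cutoff_nonneg m t)]; exact cutoff_le_one m t
  have hρ0 : ∀ (m : ℕ) t, |cutoff m t| ≤ (m : ℝ≥0) * |t| := fun m t => by
    rw [abs_of_nonneg (cutoff_nonneg m t)]; exact_mod_cast cutoff_le m t
  have hcal : ∀ m : ℕ, Continuous (calibration (K := K) (I := I) e σ (fun j => k j m) (cutoff m)) :=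
    fun m => by
      obtain ⟨C, hC⟩ := lipschitzWith_calibration (K := K) (I := I) he0 he2 he hσ
        (fun j => hkL j m) (fun j => hk1 j m) (lipschitzWith_cutoff m) (hρ1 m) (hρ0 m)
      exact hC.continuous
  have hle : ∀ m : ℕ, ENNReal.ofReal
      (S.flux fun x => calibration e σ (fun j => k j m) (cutoff m) x • u) ≤ S'.area := by
    intro m
    rw [flux_calibration_eq he0 he2 he hσ hframe (fun j => hkL j m) (fun j => hk1 j m)
      (lipschitzWith_cutoff m).continuous (hρ1 m) (hasCompactSupport_cutoff m) hb,
      ← flux_calibration_eq he0 he2 he hσ hframe (fun j => hkL j m) (fun j => hk1 j m)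
      (lipschitzWith_cutoff m).continuous (hρ1 m) (hasCompactSupport_cutoff m) hb']
    refine le_iSup_of_le (fun x => calibration e σ (fun j => k j m) (cutoff m) x • u)
      (le_iSup_of_le ((hcal m).smul continuous_const) (le_iSup_of_le (fun x => ?_) le_rfl))
    rw [norm_smul, hu, mul_one]
    exact abs_calibration_le (fun j => hk1 j m) (hρ1 m) x
  have htend : Tendsto (fun m : ℕ =>
      S.flux fun x => calibration e σ (fun j => k j m) (cutoff m) x • u) atTop (𝓝 (S.flux V)) := by
    refine tendsto_finsetSum _ fun i _ => Tendsto.const_mul _ ?_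
    set φ := S.patch i
    obtain ⟨C, hC⟩ := S.lipschitz i
    have hCd := lipschitzWith_dev.comp_lipschitzOnWith hC
    have hmem : ∀ q ∈ square, φ q ∈ level ν c := fun q hq =>
      hS (Set.mem_iUnion.2 ⟨i, q, hq, rfl⟩)
    have hJm : Measurable fun q => tripleProduct u (fderiv ℝ (dev ∘ φ) q (1, 0))
        (fderiv ℝ (dev ∘ φ) q (0, 1)) := by
      have hm := fun v : ℝ × ℝ => measurable_fderiv_apply_const ℝ (dev ∘ φ) v
      have hi := fun (a : E3) (v : ℝ × ℝ) => (measurable_const (a := a)).inner (𝕜 := ℝ) (hm v)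
      simp only [hframe]
      exact ((hi e _).mul (hi σ _)).sub ((hi e _).mul (hi σ _))
    refine tendsto_integral_of_dominated_convergence (fun _ => 2 * ((1 * C : ℝ≥0) : ℝ) ^ 2)
      (fun m => ?_) ?_ (fun m => ?_) ?_
    · simp only [tripleProduct_smul]
      exact (((hcal m).comp_continuousOn hC.continuousOn).aestronglyMeasurable
        measurableSet_square).mul hJm.aestronglyMeasurable
    · refine integrableOn_const ?_
      exact (isCompact_Icc.prod isCompact_Icc).measure_ne_top
    · rw [ae_restrict_iff' measurableSet_square]
      filter_upwards [ae_square_mem_nhds] with q hn hq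
      have hb : ∀ v : ℝ × ℝ, ‖v‖ ≤ 1 → ‖fderiv ℝ (dev ∘ φ) q v‖ ≤ (1 * C : ℝ≥0) := fun v hv => by
        refine (ContinuousLinearMap.le_opNorm _ _).trans ?_
        have h1 := norm_fderiv_le_of_lipschitzOn ℝ (hn hq) hCd
        calc _ ≤ ((1 * C : ℝ≥0) : ℝ) * 1 := by gcongr
          _ = _ := mul_one _
      have h1 := hb (1, 0) (by simp)
      have h2 := hb (0, 1) (by simp)
      have hin : ∀ a p : E3, ‖a‖ = 1 → ‖p‖ ≤ (1 * C : ℝ≥0) → |inner ℝ a p| ≤ (1 * C : ℝ≥0) :=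
        fun a p ha hp => by
          refine (abs_real_inner_le_norm _ _).trans ?_
          rwa [ha, one_mul]
      rw [tripleProduct_smul, hframe, Real.norm_eq_abs, abs_mul]
      refine (mul_le_of_le_one_left (abs_nonneg _)
        (abs_calibration_le (fun j => hk1 j m) (hρ1 m) _)).trans ?_
      refine (abs_sub _ _).trans ?_
      rw [abs_mul, abs_mul, two_mul, sq]
      exact add_le_add (mul_le_mul (hin e _ he h1) (hin σ _ hσ h2) (abs_nonneg _) (NNReal.coe_nonneg _))
        (mul_le_mul (hin e _ he h2) (hin σ _ hσ h1) (abs_nonneg _) (NNReal.coe_nonneg _))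
    · rw [ae_restrict_iff' measurableSet_square]
      filter_upwards [ae_square_mem_nhds, ae_differentiableAt_of_lipschitzOn_square hCd,
        ae_fderiv_eq_zero ((lipschitzWith_inner_dev e).comp_lipschitzOnWith hC)] with q hn hd h0 hq
      have hcomp : ∀ a : E3, HasFDerivAt ((fun x => inner ℝ a (dev x)) ∘ φ)
          ((innerSL ℝ a).comp (fderiv ℝ (dev ∘ φ) q)) q := fun a =>
        (innerSL ℝ a).hasFDerivAt.comp q (hd hq).hasFDerivAt
      have hu0 : ∀ v, inner ℝ u (fderiv ℝ (dev ∘ φ) q v) = 0 := by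
        intro v
        have hconst : HasFDerivAt ((fun x => inner ℝ u (dev x)) ∘ φ) (0 : ℝ × ℝ →L[ℝ] ℝ) q := by
          refine (hasFDerivAt_const (‖ν‖⁻¹ * c) q).congr_of_eventuallyEq ?_
          filter_upwards [hn hq] with p hp
          exact hlev _ (hmem p hp)
        have := congrArg (fun l => l v) ((hcomp u).unique hconst)
        simpa using this
      simp only [tripleProduct_smul]
      rw [tripleProduct_of_orthogonal hu (hu0 _) (hu0 _) (V _)]
      -- On the wall the cutoff prevents convergence to `h`, but there the area element vanishes
      -- almost everywhere.
      by_cases hY : inner ℝ e (dev (φ q)) = 0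
      · have hz : ∀ v, inner ℝ e (fderiv ℝ (dev ∘ φ) q v) = 0 := fun v => by
          have := congrArg (fun l => l v) ((hcomp e).fderiv.symm.trans (h0 hq hY))
          simpa using this
        have : tripleProduct u (fderiv ℝ (dev ∘ φ) q (1, 0)) (fderiv ℝ (dev ∘ φ) q (0, 1)) = 0 := by
          rw [hframe, hz, hz]; ring
        simp [this]
      · exact (hlim _ (hmem q hq) hY).mul_const _
  exact le_of_tendsto (ENNReal.tendsto_ofReal htend) (.of_forall hle)

end

section

variable {n : ℕ} [NeZero n] {K : Set (EuclideanSpace ℝ (Fin 2))} {I : Set ℝ}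

/-! ### Spanning surfaces in the leaves that meet the axis -/

/-- The homothety with centre `o` on the axis and ratio `r ∈ [0, 1]`. -/
noncomputable def CutPoint.contract {o : E3} (ho : StarConvex ℝ o (solid K I)) (ho1 : o 1 = 0)
    (r : ℝ) (a : CutPoint n K I) : CutPoint n K I where
  copy := a.copy
  upper := a.upper
  pos := (1 - clamp r) • o + clamp r • a.pos
  horizontal_mem := (ho a.pos_mem_solid (by linarith [(clamp_mem r).2]) (clamp_mem r).1 (by ring)).1
  vertical_mem := (ho a.pos_mem_solid (by linarith [(clamp_mem r).2]) (clamp_mem r).1 (by ring)).2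
  side := by
    have h := a.side
    have hr := (clamp_mem r).1
    split_ifs at h ⊢
    · simpa [ho1] using mul_nonneg hr h
    · simpa [ho1] using mul_nonpos_of_nonneg_of_nonpos hr h

theorem BrokenPath.edist_le {a b : CutPoint n K I} {l : ℝ≥0∞} (h : BrokenPath a b l) :
    edist a b ≤ l := sInf_le h

section Contract

variable {o : E3} (ho : StarConvex ℝ o (solid K I)) (ho1 : o 1 = 0)

/-- A homothety centred on the axis preserves the halves of the copies and both kinds of gluing, so
it maps broken paths to broken paths and scales their segments. -/
theorem BrokenPath.edist_contract_le (ho0 : o 0 = 0) (r : ℝ) {a b : CutPoint n K I} {l : ℝ≥0∞}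
    (h : BrokenPath a b l) :
    edist (a.contract ho ho1 r) (b.contract ho ho1 r) ≤ ENNReal.ofReal (clamp r) * l := by
  have hr := (clamp_mem r).1
  induction h with
  | segment a b hc hu =>
    refine (BrokenPath.segment (CutPoint.contract ho ho1 r a) (CutPoint.contract ho ho1 r b) hc hu).edist_le.trans (le_of_eq ?_)
    rw [edist_dist, edist_dist, ← ENNReal.ofReal_mul hr]
    congr 1
    simp [CutPoint.contract, dist_smul₀, abs_of_nonneg hr]
  | inCopy a b h =>
    obtain ⟨hp, hc, h1, h0⟩ := h
    refine (BrokenPath.inCopy (CutPoint.contract ho ho1 r a) (CutPoint.contract ho ho1 r b) ⟨?_, hc, ?_, ?_⟩).edist_le.trans (by simp)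
    · simp [CutPoint.contract, hp]
    · simp [CutPoint.contract, ho1, h1]
    · simpa [CutPoint.contract, ho0] using mul_nonpos_of_nonneg_of_nonpos hr h0
  | toNext a b h =>
    obtain ⟨hp, hau, hbu, hc, h1, h0⟩ := h
    refine (BrokenPath.toNext (CutPoint.contract ho ho1 r a) (CutPoint.contract ho ho1 r b) ⟨?_, hau, hbu, hc, ?_, ?_⟩).edist_le.trans (by simp)
    · simp [CutPoint.contract, hp]
    · simp [CutPoint.contract, ho1, h1]
    · simpa [CutPoint.contract, ho0] using mul_nonneg hr h0
  | symm h ih => rwa [edist_comm]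
  | trans h h' ih ih' =>
    rw [mul_add]
    exact (edist_triangle _ _ _).trans (add_le_add ih ih')

/-- The homothety of the cone product with centre on the axis. -/
noncomputable def contract (r : ℝ) (x : ConeProduct n K I) : ConeProduct n K I :=
  SeparationQuotient.mk ((Quotient.out x : CutPoint n K I).contract ho ho1 r)

theorem dev_contract (r : ℝ) (x : ConeProduct n K I) :
    dev (contract ho ho1 r x) = (1 - clamp r) • o + clamp r • dev x := by
  rw [contract, dev_mk, ← pos_out x]
  rfl

theorem edist_contract_le (ho0 : o 0 = 0) (r : ℝ) (x y : ConeProduct n K I) :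
    edist (contract ho ho1 r x) (contract ho ho1 r y) ≤ edist x y := by
  rw [contract, contract, SeparationQuotient.edist_mk, ← edist_out x y]
  refine le_sInf fun l hl => ?_
  refine (hl.edist_contract_le ho ho1 ho0 r).trans (mul_le_of_le_one_left zero_le ?_)
  simpa using (clamp_mem r).2

/-- Ratio `0` shrinks a broken path to length zero; the finite distance only serves to provide such
a path. -/
theorem contract_zero_eq (ho0 : o 0 = 0) {x y : ConeProduct n K I} (h : edist x y ≠ ⊤) :
    contract ho ho1 0 x = contract ho ho1 0 y := by
  rw [← edist_out x y] at h
  obtain ⟨l, hl, -⟩ := sInf_lt_iff.1 h.lt_top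
  have h1 := BrokenPath.edist_contract_le ho ho1 ho0 0 hl
  rw [clamp_of_nonpos le_rfl, ENNReal.ofReal_zero, zero_mul, nonpos_iff_eq_zero,
    ← SeparationQuotient.edist_mk] at h1
  exact edist_eq_zero.1 h1

theorem contract_one (x : ConeProduct n K I) : contract ho ho1 1 x = x := by
  have : (Quotient.out x : CutPoint n K I).contract ho ho1 1 = Quotient.out x := by
    simp [CutPoint.contract, clamp_of_one_le le_rfl]
  rw [contract, this, mk_out]

theorem edist_contract_contract_le (r r' : ℝ) (x : ConeProduct n K I) :
    edist (contract ho ho1 r x) (contract ho ho1 r' x) ≤ ‖dev x - o‖₊ * edist r r' := by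
  rw [contract, contract, SeparationQuotient.edist_mk]
  refine (BrokenPath.segment ((Quotient.out x : CutPoint n K I).contract ho ho1 r)
    ((Quotient.out x : CutPoint n K I).contract ho ho1 r') rfl rfl).edist_le.trans ?_
  have hsub : ((Quotient.out x : CutPoint n K I).contract ho ho1 r).pos -
      ((Quotient.out x : CutPoint n K I).contract ho ho1 r').pos =
      (clamp r - clamp r') • (dev x - o) := by
    rw [← pos_out x]
    simp only [CutPoint.contract]
    module
  rw [edist_eq_enorm_sub, hsub, enorm_smul, mul_comm]
  have h1 := lipschitzWith_clamp r r'
  rw [ENNReal.coe_one, one_mul, edist_eq_enorm_sub] at h1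
  exact mul_le_mul_right h1 _

theorem continuous_contract (x : ConeProduct n K I) :
    Continuous fun r => contract ho ho1 r x :=
  LipschitzWith.continuous (K := ‖dev x - o‖₊) fun r r' => edist_contract_contract_le ho ho1 r r' x

/-- The cone over `γ` with apex `o`, run from ratio `1` to ratio `0`, is a null homotopy inside `L`.
-/
theorem exists_surface_of_contract (ho0 : o 0 = 0) {L : Set (ConeProduct n K I)}
    (hL : ∀ x ∈ L, ∀ r, contract ho ho1 r x ∈ L) {γ : ℝ → ConeProduct n K I}
    (hγ : IsSimpleClosedCurve γ) (hγL : ∀ t ∈ Set.Icc (0 : ℝ) 1, γ t ∈ L) :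
    ∃ S : Surface n K I, S.carrier ⊆ L ∧ S.HasBoundary γ := by
  obtain ⟨⟨C, hC⟩, hclosed, -⟩ := hγ
  obtain ⟨B, hB⟩ := isCompact_Icc.exists_bound_of_continuousOn (f := fun t => dev (γ t) - o)
    ((lipschitzWith_dev.continuous.comp_continuousOn hC.continuousOn).sub continuousOn_const)
  set Φ : ℝ × ℝ → ConeProduct n K I := fun q => contract ho ho1 (1 - q.2) (γ q.1) with hΦ
  have hlip : ∃ C : ℝ≥0, LipschitzOnWith C Φ square := by
    refine ⟨C + B.toNNReal, fun q hq q' hq' => ?_⟩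
    rw [ENNReal.coe_add, add_mul]
    refine (edist_triangle _ (contract ho ho1 (1 - q.2) (γ q'.1)) _).trans (add_le_add ?_ ?_)
    · refine (edist_contract_le ho ho1 ho0 _ _ _).trans ((hC hq.1 hq'.1).trans ?_)
      gcongr
      exact le_max_left _ _
    · refine (edist_contract_contract_le ho ho1 _ _ _).trans ?_
      have h1 : (‖dev (γ q'.1) - o‖₊ : ℝ≥0∞) ≤ B.toNNReal := by
        rw [ENNReal.coe_le_coe]
        exact NNReal.coe_le_coe.1 ((hB _ hq'.1).trans (Real.le_coe_toNNReal B))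
      have h2 : edist (1 - q.2) (1 - q'.2) ≤ edist q q' := by
        refine le_trans (le_of_eq ?_) (le_max_right _ _)
        rw [edist_dist, edist_dist, dist_sub_left]
      gcongr
  refine ⟨Surface.single Φ hlip, ?_, Surface.hasBoundary_single hlip
    (p := contract ho ho1 0 (γ 0)) ?_ ?_ ?_⟩
  · refine Set.iUnion_subset fun i => ?_
    rintro _ ⟨q, hq, rfl⟩
    exact hL _ (hγL _ hq.1) _
  · intro t _
    simp only [Φ, sub_zero, contract_one]
  · intro t ht
    simp only [Φ, sub_self]
    refine contract_zero_eq ho ho1 ho0 (ne_top_of_le_ne_top ?_ (hC ht ⟨le_rfl, zero_le_one⟩))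
    exact ENNReal.mul_ne_top ENNReal.coe_ne_top (edist_ne_top _ _)
  · intro r _
    simp only [Φ, hclosed]

/-- The plane passes through `o`, so the homothetic images of a point form a connected subset of the
level. -/
theorem contract_mem_component {ν : E3} {c : ℝ} (hc : inner ℝ ν o = c)
    {x₀ : ConeProduct n K I} : ∀ x ∈ connectedComponentIn (level ν c) x₀, ∀ r,
      contract ho ho1 r x ∈ connectedComponentIn (level ν c) x₀ := by
  intro x hx r
  have hxl : inner ℝ ν (dev x) = c := connectedComponentIn_subset (level ν c) _ hx
  rw [connectedComponentIn_eq hx]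
  have hpre : IsPreconnected (Set.range fun r => contract ho ho1 r x) :=
    isPreconnected_range (continuous_contract ho ho1 x)
  refine hpre.subset_connectedComponentIn ⟨1, contract_one ho ho1 x⟩ ?_ ⟨r, rfl⟩
  rintro _ ⟨s, rfl⟩
  change inner ℝ ν (dev _) = c
  rw [dev_contract, inner_add_right, inner_smul_right, inner_smul_right, hc, hxl]
  ring

theorem contract_mem_axis (ho0 : o 0 = 0) {x : ConeProduct n K I} {r : ℝ} (h : x ∈ axis ∨ r ≤ 0) :
    contract ho ho1 r x ∈ axis := by
  rcases h with h | h
  · have h0 : dev x 0 = 0 := h.1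
    have h1 : dev x 1 = 0 := h.2
    constructor <;> rw [dev_contract] <;> simp [ho0, ho1, h0, h1]
  · constructor <;> rw [dev_contract] <;> simp [ho0, ho1, clamp_of_nonpos h]

/-- Only positive ratios are allowed, so that the connecting path stays off the axis. -/
theorem contract_mem_halfPlane (ho0 : o 0 = 0) {ν : E3} {c : ℝ} (hc : inner ℝ ν o = c)
    {x₀ : ConeProduct n K I} : ∀ x ∈ connectedComponentIn (level ν c \ axis) x₀, ∀ r, 0 < r →
      contract ho ho1 r x ∈ connectedComponentIn (level ν c \ axis) x₀ := by
  intro x hx r hr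
  obtain ⟨hxl, hxa⟩ := connectedComponentIn_subset _ _ hx
  have hxl : inner ℝ ν (dev x) = c := hxl
  rw [connectedComponentIn_eq hx]
  have hpre : IsPreconnected ((fun r => contract ho ho1 r x) '' Set.Ioi 0) :=
    isPreconnected_Ioi.image _ (continuous_contract ho ho1 x).continuousOn
  refine hpre.subset_connectedComponentIn ⟨1, Set.mem_Ioi.2 one_pos, contract_one ho ho1 x⟩ ?_ ⟨r, hr, rfl⟩
  rintro _ ⟨s, hs, rfl⟩
  refine ⟨?_, fun h => hxa ?_⟩
  · change inner ℝ ν (dev _) = c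
    rw [dev_contract, inner_add_right, inner_smul_right, inner_smul_right, hc, hxl]
    ring
  · have hpos : clamp s ≠ 0 := (lt_max_of_lt_right (lt_min hs one_pos)).ne'
    obtain ⟨h0, h1⟩ := h
    rw [dev_contract] at h0 h1
    simp [ho0, ho1, hpos] at h0 h1
    exact ⟨h0, h1⟩

end Contract

theorem starConvex_solid (hK : Convex ℝ K) (hI : I.OrdConnected) (hK0 : (0 : EuclideanSpace ℝ (Fin 2)) ∈ K)
    {z : ℝ} (hz : z ∈ I) : StarConvex ℝ (!₂[0, 0, z] : E3) (solid K I) := by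
  refine (convex_solid hK hI).starConvex ⟨?_, by simpa using hz⟩
  convert hK0 using 1
  ext i
  fin_cases i <;> simp

/-! ### Spanning surfaces in the leaves that miss the axis -/

theorem exists_mem_sheet {e : E3} (he0 : 0 ≤ e 0) (he2 : e 2 = 0) {x : ConeProduct n K I} {p : E3}
    (hp : p ∈ solid K I) (hpe : inner ℝ e p ≠ 0)
    (hiff : 0 < inner ℝ e (dev x) ↔ 0 < inner ℝ e p) :
    ∃ y : ConeProduct n K I, dev y = p ∧ sheet e y = sheet e x := by
  classical
  set j := sheet e x with hj
  have hj2 : j.2 = decide (0 < inner ℝ e p) := by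
    rw [hj, sheet, CutPoint.sheet, pos_out]
    simp only [hiff]
  by_cases h1 : 0 ≤ p 1
  · let a : CutPoint n K I := ⟨j.1, true, p, hp.1, hp.2, by simpa using h1⟩
    refine ⟨SeparationQuotient.mk a, rfl, ?_⟩
    rw [sheet_mk he0 he2 hpe]
    refine Prod.ext ?_ ?_
    · simp [CutPoint.sheet, a]
    · rw [hj2]
      simp [CutPoint.sheet, a]
  · let a : CutPoint n K I := ⟨if 0 < inner ℝ e p then j.1 + 1 else j.1, false, p, hp.1, hp.2,
      by simpa using (not_le.1 h1).le⟩
    refine ⟨SeparationQuotient.mk a, rfl, ?_⟩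
    rw [sheet_mk he0 he2 hpe]
    refine Prod.ext ?_ ?_
    · by_cases h : 0 < inner ℝ e p <;> simp [CutPoint.sheet, a, h]
    · rw [hj2]
      simp [CutPoint.sheet, a]

/-- Since `⟨e, ·⟩` has no zero on the plane within the solid, the component stays in one half space,
which is isometric to a convex set. The straight-line homotopy from `dev ∘ γ` to `dev (γ 0)`
therefore lifts. -/
theorem exists_surface_of_ne_zero (hK : Convex ℝ K) (hI : I.OrdConnected) {e ν : E3}
    (he0 : 0 ≤ e 0) (he2 : e 2 = 0) {c : ℝ}
    (hne : ∀ p ∈ solid K I, inner ℝ ν p = c → inner ℝ e p ≠ 0) {x₀ : ConeProduct n K I}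
    {γ : ℝ → ConeProduct n K I} (hγ : IsSimpleClosedCurve γ)
    (hγL : ∀ t ∈ Set.Icc (0 : ℝ) 1, γ t ∈ connectedComponentIn (level ν c) x₀) :
    ∃ S : Surface n K I, S.carrier ⊆ connectedComponentIn (level ν c) x₀ ∧ S.HasBoundary γ := by
  obtain ⟨⟨C, hC⟩, hclosed, -⟩ := hγ
  have hz : (0 : ℝ) ∈ Set.Icc (0 : ℝ) 1 := ⟨le_rfl, zero_le_one⟩
  have ho : (1 : ℝ) ∈ Set.Icc (0 : ℝ) 1 := ⟨zero_le_one, le_rfl⟩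
  have hlev : ∀ t ∈ Set.Icc (0 : ℝ) 1, inner ℝ ν (dev (γ t)) = c := fun t ht =>
    connectedComponentIn_subset (level ν c) _ (hγL t ht)
  have hsheetc : ContinuousOn (sheet e) (level ν c : Set (ConeProduct n K I)) := fun x hx => by
    refine ContinuousAt.continuousWithinAt ?_
    refine continuousAt_const.congr (f := fun _ => sheet e x) ?_
    filter_upwards [eventually_sheet_eq he0 he2 (hne _ (dev_mem_solid x) hx)] with y hy using hy.symm
  have hsheet : ∀ t ∈ Set.Icc (0 : ℝ) 1, sheet e (γ t) = sheet e (γ 0) := fun t ht =>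
    isPreconnected_connectedComponentIn.constant
      (hsheetc.mono (connectedComponentIn_subset _ _)) (hγL t ht) (hγL 0 hz)
  set P : ℝ × ℝ → E3 := fun q => (1 - q.2) • dev (γ q.1) + q.2 • dev (γ 0) with hP
  have hPs : ∀ q ∈ square, P q ∈ solid K I := fun q hq =>
    convex_solid hK hI (dev_mem_solid _) (dev_mem_solid _) (by linarith [hq.2.2]) hq.2.1 (by ring)
  have hPc : ∀ q ∈ square, inner ℝ ν (P q) = c := fun q hq => by
    simp only [P, inner_add_right, inner_smul_right, hlev _ hq.1, hlev _ hz]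
    ring
  -- Otherwise `⟨e, ·⟩` would vanish at the point with parameter `θ` of the segment from `p` to
  -- `p'`, which lies in the plane and in the convex solid.
  have hsign : ∀ p ∈ solid K I, ∀ p' ∈ solid K I, inner ℝ ν p = c → inner ℝ ν p' = c →
      0 < inner ℝ e p → 0 < inner ℝ e p' := by
    intro p hp p' hp' hpc hpc' h
    by_contra h'
    have hab : 0 < inner ℝ e p - inner ℝ e p' := by linarith [not_lt.1 h']
    set θ := inner ℝ e p / (inner ℝ e p - inner ℝ e p') with hθ
    have hθ0 : 0 ≤ θ := by positivity
    have hθ1 : 0 ≤ 1 - θ := by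
      rw [sub_nonneg, hθ, div_le_one hab]
      linarith [not_lt.1 h']
    refine hne _ (convex_solid hK hI hp hp' hθ1 hθ0 (by ring)) ?_ ?_
    · rw [inner_add_right, inner_smul_right, inner_smul_right, hpc, hpc']
      ring
    · rw [inner_add_right, inner_smul_right, inner_smul_right, hθ]
      field_simp
      ring
  have hex : ∀ q, ∃ y : ConeProduct n K I,
      q ∈ square → dev y = P q ∧ sheet e y = sheet e (γ 0) := by
    intro q
    by_cases hq : q ∈ square
    · obtain ⟨y, hy⟩ := exists_mem_sheet (x := γ 0) he0 he2 (hPs q hq) (hne _ (hPs q hq) (hPc q hq))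
        ⟨hsign _ (dev_mem_solid _) _ (hPs q hq) (hlev 0 hz) (hPc q hq),
          hsign _ (hPs q hq) _ (dev_mem_solid _) (hPc q hq) (hlev 0 hz)⟩
      exact ⟨y, fun _ => hy⟩
    · exact ⟨γ 0, fun h => absurd h hq⟩
  choose Φ hΦ using hex
  have heq : ∀ x y : ConeProduct n K I, x ∈ level ν c → dev x = dev y →
      sheet e x = sheet e y → x = y := by
    intro x y hx hd hs
    have hxe := hne _ (dev_mem_solid x) hx
    have := edist_le_of_sheet_eq hK hI he0 he2 hs hxe (by rwa [← hd])
    rw [hd, edist_self, nonpos_iff_eq_zero, edist_eq_zero] at this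
    exact this
  have hΦl : ∀ q ∈ square, Φ q ∈ level ν c := fun q hq => by
    change inner ℝ ν (dev _) = c
    rw [(hΦ q hq).1, hPc q hq]
  have hΦiso : ∀ q ∈ square, ∀ q' ∈ square, edist (Φ q) (Φ q') ≤ edist (P q) (P q') := by
    intro q hq q' hq'
    rw [← (hΦ q hq).1, ← (hΦ q' hq').1]
    exact edist_le_of_sheet_eq hK hI he0 he2 ((hΦ q hq).2.trans (hΦ q' hq').2.symm)
      (hne _ (dev_mem_solid _) (hΦl q hq)) (hne _ (dev_mem_solid _) (hΦl q' hq'))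
  obtain ⟨B, hB⟩ := isCompact_Icc.exists_bound_of_continuousOn
    (f := fun t => dev (γ 0) - dev (γ t))
    (continuousOn_const.sub (lipschitzWith_dev.continuous.comp_continuousOn hC.continuousOn))
  have hPlip : LipschitzOnWith (C + B.toNNReal) P square := by
    refine LipschitzOnWith.of_dist_le_mul fun q hq q' hq' => ?_
    have hd := (lipschitzWith_dev.comp_lipschitzOnWith hC).dist_le_mul _ hq.1 _ hq'.1
    simp only [Function.comp, one_mul, dist_eq_norm (dev _)] at hd
    have h1 : |q.1 - q'.1| ≤ dist q q' := le_max_left _ _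
    have h2 : |q.2 - q'.2| ≤ dist q q' := le_max_right _ _
    have hsplit : P q - P q' = (1 - q.2) • (dev (γ q.1) - dev (γ q'.1)) +
        (q.2 - q'.2) • (dev (γ 0) - dev (γ q'.1)) := by
      simp only [P]
      module
    rw [dist_eq_norm, hsplit, NNReal.coe_add, add_mul]
    refine (norm_add_le _ _).trans (add_le_add ?_ ?_)
    · rw [norm_smul, Real.norm_of_nonneg (by linarith [hq.2.2])]
      refine (mul_le_of_le_one_left (norm_nonneg _) (by linarith [hq.2.1])).trans (hd.trans ?_)
      rw [Real.dist_eq]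
      gcongr
    · rw [norm_smul, mul_comm]
      have := (hB _ hq'.1).trans (Real.le_coe_toNNReal B)
      exact mul_le_mul this h2 (norm_nonneg _) (NNReal.coe_nonneg _)
  have hlip : LipschitzOnWith (C + B.toNNReal) Φ square := fun q hq q' hq' =>
    (hΦiso q hq q' hq').trans (hPlip hq hq')
  have h0 : ∀ t ∈ Set.Icc (0 : ℝ) 1, Φ (t, 0) = γ t := fun t ht => by
    refine heq _ _ (hΦl _ ⟨ht, hz⟩) ?_ ((hΦ _ ⟨ht, hz⟩).2.trans (hsheet t ht).symm)
    rw [(hΦ _ ⟨ht, hz⟩).1]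
    simp [P]
  refine ⟨Surface.single Φ ⟨_, hlip⟩, ?_, Surface.hasBoundary_single ⟨_, hlip⟩ (p := γ 0) h0 ?_ ?_⟩
  · refine Set.iUnion_subset fun i => ?_
    rintro _ ⟨⟨t, r⟩, hq, rfl⟩
    rw [connectedComponentIn_eq (hγL t hq.1)]
    have hpre : IsPreconnected ((fun r => Φ (t, r)) '' Set.Icc (0 : ℝ) 1) := by
      refine isPreconnected_Icc.image _ (hlip.continuousOn.comp (by fun_prop) ?_)
      exact fun r hr => ⟨hq.1, hr⟩
    refine hpre.subset_connectedComponentIn ⟨0, hz, h0 t hq.1⟩ ?_ ⟨r, hq.2, rfl⟩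
    rintro _ ⟨s, hs, rfl⟩
    exact hΦl _ ⟨hq.1, hs⟩
  · intro t ht
    refine heq _ _ (hΦl _ ⟨ht, ho⟩) ?_ (hΦ _ ⟨ht, ho⟩).2
    rw [(hΦ _ ⟨ht, ho⟩).1]
    simp [P]
  · intro r hr
    refine heq _ _ (hΦl _ ⟨hz, hr⟩) ?_ ((hΦ _ ⟨hz, hr⟩).2.trans (hΦ _ ⟨ho, hr⟩).2.symm)
    rw [(hΦ _ ⟨hz, hr⟩).1, (hΦ _ ⟨ho, hr⟩).1]
    simp [P, hclosed]

/-! ### The theorem -/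

theorem IsLeaf.subset_level {ν : E3} {L : Set (ConeProduct n K I)} (hL : IsLeaf ν L) :
    ∃ c, L ⊆ level ν c := by
  cases hL with
  | component x => exact ⟨_, connectedComponentIn_subset _ _⟩
  | halfPlanes c hc x y =>
    refine ⟨c, Set.union_subset (Set.union_subset hc ?_) ?_⟩ <;>
    exact (connectedComponentIn_subset _ _).trans Set.sdiff_subset

theorem IsLeaf.exists_surface (hK : Convex ℝ K) (hK0 : 0 ∈ interior K) (hI : I.OrdConnected)
    (hI0 : (interior I).Nonempty) {ν : E3} {L : Set (ConeProduct n K I)} (hL : IsLeaf ν L)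
    {γ : ℝ → ConeProduct n K I} (hγ : IsSimpleClosedCurve γ)
    (hγL : ∀ t ∈ Set.Icc (0 : ℝ) 1, γ t ∈ L) :
    ∃ S : Surface n K I, S.carrier ⊆ L ∧ S.HasBoundary γ := by
  have hK0' := interior_subset hK0
  cases hL with
  | component x =>
    set c := inner ℝ ν (dev x)
    -- Does the plane meet the axis over `I`? If not, the horizontal part of `ν` pairs nontrivially
    -- with every point of the plane in the solid, and serves as `e` after a sign change giving `0 ≤
    -- e 0`.
    by_cases hA : ∃ z ∈ I, ν 2 * z = c
    · obtain ⟨z, hz, hzc⟩ := hA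
      exact exists_surface_of_contract (starConvex_solid hK hI hK0' hz) (by simp) (by simp)
        (contract_mem_component _ _ (by simpa [inner_eq_sum] using hzc)) hγ hγL
    · push Not at hA
      have hne : ∀ p ∈ solid K I, inner ℝ ν p = c → ν 0 * p 0 + ν 1 * p 1 ≠ 0 := by
        intro p hp hpc h
        refine hA (p 2) hp.2 ?_
        rw [← hpc, inner_eq_sum, h, zero_add]
      rcases le_total 0 (ν 0) with h0 | h0
      · refine exists_surface_of_ne_zero hK hI (e := !₂[ν 0, ν 1, 0]) (by simpa using h0) (by simp)
          (fun p hp hpc => ?_) hγ hγL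
        simpa [inner_eq_sum] using hne p hp hpc
      · refine exists_surface_of_ne_zero hK hI (e := !₂[-ν 0, -ν 1, 0]) (by simpa using h0) (by simp)
          (fun p hp hpc h => hne p hp hpc ?_) hγ hγL
        simp [inner_eq_sum] at h
        linarith
  | halfPlanes c hc x y hx hy hxy =>
    obtain ⟨z, hz⟩ := hI0
    have hz := interior_subset hz
    have hstar := starConvex_solid hK hI hK0' hz
    have h0 : (!₂[0, 0, z] : E3) 0 = 0 := by simp
    have h1 : (!₂[0, 0, z] : E3) 1 = 0 := by simp
    -- Ratio `0` turns `x` into a point of the axis at height `z`; as the axis lies in the level,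
    -- the centre lies on the plane.
    have hmem := contract_mem_axis (x := x) (r := 0) hstar h1 h0 (Or.inr le_rfl)
    have hoc : inner ℝ ν (!₂[0, 0, z] : E3) = c := by
      have : inner ℝ ν (dev (contract hstar h1 0 x)) = c := hc hmem
      rw [dev_contract, clamp_of_nonpos le_rfl] at this
      simpa using this
    refine exists_surface_of_contract hstar h1 h0 (fun p hp r => ?_) hγ hγL
    rcases le_or_gt r 0 with hr | hr
    · exact Or.inl (Or.inl (contract_mem_axis _ h1 h0 (Or.inr hr)))
    rcases hp with (hp | hp) | hp
    · exact Or.inl (Or.inl (contract_mem_axis _ h1 h0 (Or.inl hp)))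
    · exact Or.inl (Or.inr (contract_mem_halfPlane _ h1 h0 hoc p hp r hr))
    · exact Or.inr (contract_mem_halfPlane _ h1 h0 hoc p hp r hr)

end

end FlatCone

theorem theorem5 (n : ℕ) [NeZero n] (K : Set (EuclideanSpace ℝ (Fin 2))) (hK : Convex ℝ K)
    (hK0 : 0 ∈ interior K) (I : Set ℝ) (hI : I.OrdConnected) (hI0 : (interior I).Nonempty)
    (ν : FlatCone.E3) (hν : ν ≠ 0) (L : Set (FlatCone.ConeProduct n K I))
    (hL : FlatCone.IsLeaf ν L) : FlatCone.IsAreaMinimizing L := by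
  intro γ hγ hγL
  obtain ⟨S, hSL, hSγ⟩ := hL.exists_surface hK hK0 hI hI0 hγ hγL
  obtain ⟨c, hc⟩ := hL.subset_level
  exact ⟨S, hSL, hSγ, fun S' hS' => FlatCone.area_le_area hK hI hν (hSL.trans hc) hSγ hS'⟩
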